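/- Let $E,F,T_1,T_2,N\in\mathbb N$, and let $Y\in\mathbb R^{E\times T_1\times T_2}$, $O\in\{0,1\}^{E\times T_1\times T_2}$, $W\in\mathbb R_{>0}^{E\times T_1\times T_2}$, $R\in\mathbb R^{E\times F}$, $M\in\mathbb R_{>0}^{F\times T_1\times T_2}$, $\lambda>0$, $\nu>0$. Put $\widetilde O=O\odot W$, where $\odot$ and $\oslash$ denote entrywise multiplication and division and $\mathcal T^2$ the entrywise square. For $P\in\mathbb R^{E\times N}$, $Q_1\in\mathbb R^{T_1\times N}$, $Q_2\in\mathbb R^{T_2\times N}$ let $[\![P,Q_1,Q_2]\!]_{j,t_1,t_2}=\sum_{r=1}^N P_{jr}(Q_1)_{t_1r}(Q_2)_{t_2r}$; let $(\mathcal T\times_1 B)_{i',t_1,t_2}=\sum_i B_{i'i}\mathcal T_{i,t_1,t_2}$, let $\mathcal T_{(n)}$ be the mode-$n$ unfolding, $\circledast$ the Khatri-Rao product, $\|\cdot\|_F$ the Frobenius norm, $\|\cdot\|_1$ the entrywise $\ell_1$-norm, and $[\mathcal T]_\Sigma$ the sum of all entries of $\mathcal T$. Let $$f_{\rm aug}(\widetilde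 X,P,Q_1,Q_2,A)=\tfrac12\|\widetilde O\odot(Y-\widetilde X-A\times_1R)\|_F^2+\tfrac\nu2\|\widetilde X-[\![P,Q_1,Q_2]\!]\|_F^2+\|M\odot A\|_1+\tfrac\lambda2\left(\|P\|_F^2+\|Q_1\|_F^2+\|Q_2\|_F^2\right)$$ for $\widetilde X\in\mathbb R^{E\times T_1\times T_2}$ and $A\in\mathbb R^{F\times T_1\times T_2}$. Define the updates $$\widetilde X(P,Q_1,Q_2,A)=\left(\widetilde O^2\odot(Y-A\times_1R)+\nu[\![P,Q_1,Q_2]\!]\right)\oslash(\widetilde O^2+\nu\mathbf 1),$$ $$P_{\rm aug}(\widetilde X,Q_1,Q_2)=\widetilde X_{(1)}(Q_2\circledast Q_1)\left((Q_1^TQ_1)\odot(Q_2^TQ_2)+\tfrac\lambda\nu I\right)^{-1},$$ $$Q_{1,\rm aug}(\widetilde X,P,Q_2)=\widetilde X_{(2)}(Q_2\circledast P)\left((P^TP)\odot(Q_2^TQ_2)+\tfrac\lambda\nu I\right)^{-1},$$ $$Q_{2,\rm aug}(\widetilde X,P,Q_1)=\widetilde X_{(3)}(Q_1\circledast P)\left((P^TP)\odot(Q_1^TQ_1)+\tfrac\lambda\nu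 I\right)^{-1},$$ $$\widetilde A(\widetilde X,A_0)=\mathcal S_M\!\left(\left[\widetilde O^2\odot(Y-\widetilde X-A_0\times_1R)\right]\times_1R^T+G\odot A_0\right)\oslash G,\qquad G=\widetilde O^2\times_1(R^2)^T,$$ where $\mathcal S_M$ is entrywise soft-thresholding with thresholds $M$ and an entry of $\widetilde A$ at which $G$ vanishes is set to $0$. Let the step size be $$\gamma^*(\widetilde X,\widetilde A,A_0)=\left[-\frac{\left[\widetilde O^2\odot(\widetilde X+A_0\times_1R-Y)\odot((\widetilde A-A_0)\times_1R)\right]_\Sigma+\|M\odot\widetilde A\|_1-\|M\odot A_0\|_1}{\|\widetilde O\odot((\widetilde A-A_0)\times_1R)\|_F^2}\right]_0^1,$$ where $[\cdot]_0^1$ is the projection onto $[0,1]$; if the denominator is $0$, then $\gamma^*=1$ if the numerator of the fraction is $\le0$ and $\gamma^*=0$ otherwise. Starting from arbitrary $P^0,Q_1^0,Q_2^0,A^0$, iterate for $\ell=1,2,\dots$: $\ \widehat X^\ell=\widetilde X(P^{\ell-1},Q_1^{\ell-1},Q_2^{\ell-1},A^{\ell-1})$, $P^\ell=P_{\rm aug}(\widehat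 X^\ell,Q_1^{\ell-1},Q_2^{\ell-1})$, $Q_1^\ell=Q_{1,\rm aug}(\widehat X^\ell,P^\ell,Q_2^{\ell-1})$, $Q_2^\ell=Q_{2,\rm aug}(\widehat X^\ell,P^\ell,Q_1^\ell)$, $\widetilde X^\ell=\widetilde X(P^\ell,Q_1^\ell,Q_2^\ell,A^{\ell-1})$, $\widetilde A^\ell=\widetilde A(\widetilde X^\ell,A^{\ell-1})$, $A^\ell=A^{\ell-1}+\gamma^*(\widetilde X^\ell,\widetilde A^\ell,A^{\ell-1})\,(\widetilde A^\ell-A^{\ell-1})$. Call $z$ a stationary point of minimizing $f$ over a convex set $C$ if $z\in C$ and for every $w\in C$ the one-sided directional derivative $f'(z;w-z)$ exists and is nonnegative. Then every limit point (limit of a subsequence) of $(\widetilde X^\ell,P^\ell,Q_1^\ell,Q_2^\ell,A^\ell)_{\ell\ge1}$ is a stationary point of minimizing $f_{\rm aug}$ over all $(\widetilde X,P,Q_1,Q_2,A)$. If instead both $\widetilde X$-updates are replaced by their entrywise projection onto $[0,\infty)$, i.e. $\widetilde X(P,Q_1,Q_2,A)=\left[\left(\widetilde O^2\odot(Y-A\times_1R)+\nu[\![P,Q_1,Q_2]\!]\right)\oslash(\widetilde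 O^2+\nu\mathbf 1)\right]_0^\infty$, then every limit point of the resulting sequence is a stationary point of minimizing $f_{\rm aug}$ subject to $\widetilde X\ge0$. -/

import Mathlib

open Filter Topology

noncomputable section

/-- Real third-order tensors of size `I × J × K`. -/
abbrev Tensor (I J K : ℕ) : Type := Fin I → Fin J → Fin K → ℝ

namespace Tensor

variable {I J K : ℕ}

/-- Squared Frobenius norm. -/
def frobSq (X : Tensor I J K) : ℝ := ∑ i, ∑ j, ∑ k, X i j k ^ 2

/-- Entrywise `ℓ₁`-norm. -/
def l1 (X : Tensor I J K) : ℝ := ∑ i, ∑ j, ∑ k, |X i j k|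

/-- Sum of all elements. -/
def total (X : Tensor I J K) : ℝ := ∑ i, ∑ j, ∑ k, X i j k

/-- The `1`-mode product `X ×₁ B`, whose mode-1 unfolding is `B` times that of `X`. -/
def modeOne {I' : ℕ} (X : Tensor I J K) (B : Matrix (Fin I') (Fin I) ℝ) : Tensor I' J K :=
  fun i' j k => ∑ i, B i' i * X i j k

/-- Mode-1 unfolding; the columns are indexed by the pair (third index, second index). -/
def unfoldOne (X : Tensor I J K) : Matrix (Fin I) (Fin K × Fin J) ℝ :=
  Matrix.of fun i c => X i c.2 c.1

/-- Mode-2 unfolding; the columns are indexed by the pair (third index, first index). -/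
def unfoldTwo (X : Tensor I J K) : Matrix (Fin J) (Fin K × Fin I) ℝ :=
  Matrix.of fun j c => X c.2 j c.1

/-- Mode-3 unfolding; the columns are indexed by the pair (second index, first index). -/
def unfoldThree (X : Tensor I J K) : Matrix (Fin K) (Fin J × Fin I) ℝ :=
  Matrix.of fun k c => X c.2 c.1 k

/-- The CPD tensor `⟦A, B, C⟧ = ∑ᵣ A(:,r) ∘ B(:,r) ∘ C(:,r)`. -/
def cpd {N : ℕ} (A : Matrix (Fin I) (Fin N) ℝ) (B : Matrix (Fin J) (Fin N) ℝ)
    (C : Matrix (Fin K) (Fin N) ℝ) : Tensor I J K :=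
  fun i j k => ∑ r, A i r * B j r * C k r

end Tensor

/-- Khatri-Rao (columnwise Kronecker) product. -/
def khatriRao {I J N : ℕ} (A : Matrix (Fin I) (Fin N) ℝ) (B : Matrix (Fin J) (Fin N) ℝ) :
    Matrix (Fin I × Fin J) (Fin N) ℝ :=
  Matrix.of fun c r => A c.1 r * B c.2 r

/-- Squared Frobenius norm of a matrix. -/
def matFrobSq {I J : ℕ} (A : Matrix (Fin I) (Fin J) ℝ) : ℝ := ∑ i, ∑ j, A i j ^ 2

/-- Soft-thresholding with threshold `μ`. -/
def softThreshold (μ x : ℝ) : ℝ := Real.sign x * max (|x| - μ) 0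

/-- The data of the augmented recovery problem: `E` links, `F` flows, `T₁ × T₂` time steps. -/
structure AugData (E F T₁ T₂ : ℕ) where
  /-- measurements -/
  Y : Tensor E T₁ T₂
  /-- observation mask -/
  O : Tensor E T₁ T₂
  /-- weights of the observations -/
  W : Tensor E T₁ T₂
  /-- routing matrix -/
  R : Matrix (Fin E) (Fin F) ℝ
  /-- weights of the sparsity penalty -/
  M : Tensor F T₁ T₂
  /-- rank regularization parameter -/
  lam : ℝ
  /-- augmentation parameter -/
  nu : ℝ

/-- The variables `(P, Q₁, Q₂, A)`; `N` is the maximum CPD rank. -/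
abbrev Factors (E F T₁ T₂ N : ℕ) : Type :=
  Matrix (Fin E) (Fin N) ℝ × Matrix (Fin T₁) (Fin N) ℝ × Matrix (Fin T₂) (Fin N) ℝ × Tensor F T₁ T₂

/-- The variables `(X̃, P, Q₁, Q₂, A)` of the augmented problem. -/
abbrev AugState (E F T₁ T₂ N : ℕ) : Type := Tensor E T₁ T₂ × Factors E F T₁ T₂ N

namespace AugData

variable {E F T₁ T₂ N : ℕ} (D : AugData E F T₁ T₂)

/-- The weighted mask `Õ = O ⊙ W`. -/
def maskW : Tensor E T₁ T₂ := D.O * D.W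

/-- The augmented objective. -/
def fAug : AugState E F T₁ T₂ N → ℝ := fun (X, P, Q₁, Q₂, A) =>
  1 / 2 * (D.maskW * (D.Y - X - A.modeOne D.R)).frobSq
    + D.nu / 2 * (X - Tensor.cpd P Q₁ Q₂).frobSq
    + (D.M * A).l1
    + D.lam / 2 * (matFrobSq P + matFrobSq Q₁ + matFrobSq Q₂)

/-- The constraint set `X̃ ≥ 0`. -/
def nonnegSet : Set (AugState E F T₁ T₂ N) := {z | ∀ j t₁ t₂, 0 ≤ z.1 j t₁ t₂}

/-- The block update of `X̃` (division of tensors is entrywise). -/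
def xUpdate (P : Matrix (Fin E) (Fin N) ℝ) (Q₁ : Matrix (Fin T₁) (Fin N) ℝ)
    (Q₂ : Matrix (Fin T₂) (Fin N) ℝ) (A : Tensor F T₁ T₂) : Tensor E T₁ T₂ :=
  fun j t₁ t₂ =>
    (D.maskW j t₁ t₂ ^ 2 * (D.Y j t₁ t₂ - A.modeOne D.R j t₁ t₂)
        + D.nu * Tensor.cpd P Q₁ Q₂ j t₁ t₂)
      / (D.maskW j t₁ t₂ ^ 2 + D.nu)

/-- The block update of `X̃` with elementwise projection onto `[0, ∞)`. -/
def xUpdateNonneg (P : Matrix (Fin E) (Fin N) ℝ) (Q₁ : Matrix (Fin T₁) (Fin N) ℝ)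
    (Q₂ : Matrix (Fin T₂) (Fin N) ℝ) (A : Tensor F T₁ T₂) : Tensor E T₁ T₂ :=
  fun j t₁ t₂ => max (D.xUpdate P Q₁ Q₂ A j t₁ t₂) 0

/-- The matrix `(Bᵀ B) ⊙ (Cᵀ C) + (λ/ν) I` of the factor updates. -/
def gram {I J : ℕ} (B : Matrix (Fin I) (Fin N) ℝ) (C : Matrix (Fin J) (Fin N) ℝ) :
    Matrix (Fin N) (Fin N) ℝ :=
  Matrix.hadamard (B.transpose * B) (C.transpose * C) + (D.lam / D.nu) • 1

/-- The block update of `P`. -/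
def pUpdate (X : Tensor E T₁ T₂) (Q₁ : Matrix (Fin T₁) (Fin N) ℝ)
    (Q₂ : Matrix (Fin T₂) (Fin N) ℝ) : Matrix (Fin E) (Fin N) ℝ :=
  X.unfoldOne * khatriRao Q₂ Q₁ * (D.gram Q₁ Q₂)⁻¹

/-- The block update of `Q₁`. -/
def q₁Update (X : Tensor E T₁ T₂) (P : Matrix (Fin E) (Fin N) ℝ)
    (Q₂ : Matrix (Fin T₂) (Fin N) ℝ) : Matrix (Fin T₁) (Fin N) ℝ :=
  X.unfoldTwo * khatriRao Q₂ P * (D.gram P Q₂)⁻¹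

/-- The block update of `Q₂`. -/
def q₂Update (X : Tensor E T₁ T₂) (P : Matrix (Fin E) (Fin N) ℝ)
    (Q₁ : Matrix (Fin T₁) (Fin N) ℝ) : Matrix (Fin T₂) (Fin N) ℝ :=
  X.unfoldThree * khatriRao Q₁ P * (D.gram P Q₁)⁻¹

/-- The denominator `Õ² ×₁ (R²)ᵀ` of the update of `A` (squares are entrywise). -/
def aDenom : Tensor F T₁ T₂ :=
  (D.maskW ^ 2).modeOne (Matrix.of fun i j => D.R j i ^ 2)

/-- The best response `Ã(X, A₀)` of the decoupled approximation. Where the denominator vanishes,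
so does the thresholded number, the approximation reduces to `M |a|` plus a constant, and the value `0` given by `x / 0 = 0` is its minimizer. -/
def aBest (X : Tensor E T₁ T₂) (A₀ : Tensor F T₁ T₂) : Tensor F T₁ T₂ :=
  fun i t₁ t₂ =>
    softThreshold (D.M i t₁ t₂)
      ((D.maskW ^ 2 * (D.Y - X - A₀.modeOne D.R)).modeOne D.R.transpose i t₁ t₂
        + D.aDenom i t₁ t₂ * A₀ i t₁ t₂)
      / D.aDenom i t₁ t₂

/-- Numerator in the step size: the slope at `γ = 0` of the majorizing function
`γ (‖M ⊙ Ã‖₁ - ‖M ⊙ A₀‖₁) + ½ ‖Õ ⊙ (Y - X - (A₀ + γ (Ã - A₀)) ×₁ R)‖²`. -/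
def stepNum (X : Tensor E T₁ T₂) (A' A₀ : Tensor F T₁ T₂) : ℝ :=
  (D.maskW ^ 2 * (X + A₀.modeOne D.R - D.Y) * (A' - A₀).modeOne D.R).total
    + (D.M * A').l1 - (D.M * A₀).l1

/-- Denominator in the step size: the curvature of the majorizing function. -/
def stepDen (A' A₀ : Tensor F T₁ T₂) : ℝ :=
  (D.maskW * (A' - A₀).modeOne D.R).frobSq

/-- The step size `[-num / den]₀¹`, the minimizer over `[0, 1]` of the majorizing function. If
`den = 0`, this function is affine with slope `num`, and the quotient is read as `±∞`. -/
def stepSize (X : Tensor E T₁ T₂) (A' A₀ : Tensor F T₁ T₂) : ℝ :=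
  if D.stepDen A' A₀ = 0 then (if D.stepNum X A' A₀ ≤ 0 then 1 else 0)
  else max 0 (min 1 (-(D.stepNum X A' A₀ / D.stepDen A' A₀)))

/-- One iteration of the algorithm, for a given update rule `upd` of `X̃`. -/
def step (upd : Matrix (Fin E) (Fin N) ℝ → Matrix (Fin T₁) (Fin N) ℝ →
      Matrix (Fin T₂) (Fin N) ℝ → Tensor F T₁ T₂ → Tensor E T₁ T₂) :
    Factors E F T₁ T₂ N → AugState E F T₁ T₂ N := fun (P₀, Q₁₀, Q₂₀, A₀) =>
  let X' := upd P₀ Q₁₀ Q₂₀ A₀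
  let P := D.pUpdate X' Q₁₀ Q₂₀
  let Q₁ := D.q₁Update X' P Q₂₀
  let Q₂ := D.q₂Update X' P Q₁
  let X := upd P Q₁ Q₂ A₀
  let A' := D.aBest X A₀
  let γ := D.stepSize X A' A₀
  (X, P, Q₁, Q₂, A₀ + γ • (A' - A₀))

/-- The iterates of the algorithm started at `z₀`; entry `ℓ` of the sequence is the iterate after
`ℓ + 1` iterations (the initialization has no `X̃`). -/
def iterates (upd : Matrix (Fin E) (Fin N) ℝ → Matrix (Fin T₁) (Fin N) ℝ →
      Matrix (Fin T₂) (Fin N) ℝ → Tensor F T₁ T₂ → Tensor E T₁ T₂)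
    (z₀ : Factors E F T₁ T₂ N) : ℕ → AugState E F T₁ T₂ N
  | 0 => D.step upd z₀
  | ℓ + 1 => D.step upd (iterates upd z₀ ℓ).2

end AugData

/-- `z` is a limit point of the sequence `u`: some subsequence converges to it. -/
def IsLimitPoint {V : Type*} [TopologicalSpace V] (u : ℕ → V) (z : V) : Prop :=
  ∃ φ : ℕ → ℕ, StrictMono φ ∧ Tendsto (u ∘ φ) atTop (𝓝 z)

/-- `z` is a stationary point of minimizing `f` over the convex set `C`: it is feasible, and the
one-sided directional derivative of `f` at `z` towards each feasible point exists and is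
nonnegative. -/
def IsStationaryOn {V : Type*} [AddCommGroup V] [Module ℝ V] (f : V → ℝ) (C : Set V) (z : V) :
    Prop :=
  z ∈ C ∧ ∀ w ∈ C, ∃ d : ℝ, 0 ≤ d ∧
    HasDerivWithinAt (fun t : ℝ => f (z + t • (w - z))) d (Set.Ici 0) 0

end

/-! Because `ν > 0` and `λ > 0`, `fAug` is strongly convex in each of `X̃`, `P`, `Q₁`, `Q₂`
separately. Each of these updates is an exact block minimization, so it lowers the objective by at
least a fixed multiple of the squared change of its block (`fAug_x_descent`, `fAug_p_descent` and
analogues). The factor updates are ridge regressions for the unfoldings of `X̃` (`ridge_normal`).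
There is no such bound for `A`. Instead, `fAug_a_descent` compares the step with every fixed `t ∈
[0, 1]` on the segment towards the best response, so the possibly discontinuous step size never has
to pass to a limit. The objective is nonnegative and decreasing, so its decrements tend to zero.
Along a convergent subsequence, the blocks `X̃`, `P`, `Q₁`, `Q₂` of the next iteration therefore
have the same limits as the current ones, and their optimality conditions pass to the limit. For
`A`, the limiting quadratic in `t` is nonnegative on `[0, 1]`, so its slope at zero is nonnegative.
By `aGrad_varIneq`, `A` is then a fixed point of the best response and optimal in its block.
Finally, the only nonsmooth term depends on `A` alone. Directional derivatives thus split over the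
blocks, and blockwise optimality gives stationarity (`fAug_isStationaryOn`). -/

namespace Tensor

/-! ### Bilinear algebra of tensors -/

variable {I J K : ℕ}

/-- The Frobenius inner product of tensors. -/
def inn (X Y : Tensor I J K) : ℝ := ∑ i, ∑ j, ∑ k, X i j k * Y i j k

theorem frobSq_add (X Y : Tensor I J K) :
    (X + Y).frobSq = X.frobSq + 2 * X.inn Y + Y.frobSq := by
  simp only [frobSq, inn, Finset.mul_sum, ← Finset.sum_add_distrib, Pi.add_apply]
  refine Finset.sum_congr rfl fun i _ => Finset.sum_congr rfl fun j _ =>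
    Finset.sum_congr rfl fun k _ => ?_
  ring

theorem frobSq_nonneg (X : Tensor I J K) : 0 ≤ X.frobSq := by
  unfold frobSq; positivity

theorem sq_le_frobSq (X : Tensor I J K) (i : Fin I) (j : Fin J) (k : Fin K) :
    X i j k ^ 2 ≤ X.frobSq := by
  unfold frobSq
  refine le_trans ?_ (Finset.single_le_sum (f := fun i => ∑ j, ∑ k, X i j k ^ 2)
    (fun _ _ => by positivity) (Finset.mem_univ i))
  refine le_trans ?_ (Finset.single_le_sum (f := fun j => ∑ k, X i j k ^ 2)
    (fun _ _ => by positivity) (Finset.mem_univ j))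
  exact Finset.single_le_sum (f := fun k => X i j k ^ 2)
    (fun _ _ => by positivity) (Finset.mem_univ k)

theorem l1_nonneg (X : Tensor I J K) : 0 ≤ X.l1 := by
  unfold l1; positivity

theorem inn_add_left (X Y Z : Tensor I J K) : (X + Y).inn Z = X.inn Z + Y.inn Z := by
  simp only [inn, ← Finset.sum_add_distrib, Pi.add_apply, add_mul]

theorem inn_add_right (X Y Z : Tensor I J K) : X.inn (Y + Z) = X.inn Y + X.inn Z := by
  simp only [inn, ← Finset.sum_add_distrib, Pi.add_apply, mul_add]

theorem inn_smul_left (c : ℝ) (X Y : Tensor I J K) : (c • X).inn Y = c * X.inn Y := by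
  simp only [inn, Finset.mul_sum, Pi.smul_apply, smul_eq_mul, mul_assoc]

theorem inn_neg_right (X Y : Tensor I J K) : X.inn (-Y) = -X.inn Y := by
  simp only [inn, ← Finset.sum_neg_distrib, Pi.neg_apply, mul_neg]

theorem frobSq_neg (X : Tensor I J K) : (-X).frobSq = X.frobSq := by
  simp [frobSq]

theorem frobSq_smul (c : ℝ) (X : Tensor I J K) : (c • X).frobSq = c ^ 2 * X.frobSq := by
  simp only [frobSq, Finset.mul_sum, Pi.smul_apply, smul_eq_mul, mul_pow]

theorem modeOne_add {I' : ℕ} (X Y : Tensor I J K) (B : Matrix (Fin I') (Fin I) ℝ) :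
    (X + Y).modeOne B = X.modeOne B + Y.modeOne B := by
  ext i j k
  simp [modeOne, mul_add, Finset.sum_add_distrib]

theorem modeOne_smul {I' : ℕ} (c : ℝ) (X : Tensor I J K) (B : Matrix (Fin I') (Fin I) ℝ) :
    (c • X).modeOne B = c • X.modeOne B := by
  ext i j k
  simp only [modeOne, Pi.smul_apply, smul_eq_mul, Finset.mul_sum]
  exact Finset.sum_congr rfl fun i _ => by ring

variable {N : ℕ}

theorem cpd_add_one (A A' : Matrix (Fin I) (Fin N) ℝ) (B : Matrix (Fin J) (Fin N) ℝ)
    (C : Matrix (Fin K) (Fin N) ℝ) : cpd (A + A') B C = cpd A B C + cpd A' B C := by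
  ext i j k
  simp [cpd, add_mul, Finset.sum_add_distrib]

theorem cpd_add_two (A : Matrix (Fin I) (Fin N) ℝ) (B B' : Matrix (Fin J) (Fin N) ℝ)
    (C : Matrix (Fin K) (Fin N) ℝ) : cpd A (B + B') C = cpd A B C + cpd A B' C := by
  ext i j k
  simp [cpd, add_mul, mul_add, Finset.sum_add_distrib]

theorem cpd_add_three (A : Matrix (Fin I) (Fin N) ℝ) (B : Matrix (Fin J) (Fin N) ℝ)
    (C C' : Matrix (Fin K) (Fin N) ℝ) : cpd A B (C + C') = cpd A B C + cpd A B C' := by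
  ext i j k
  simp [cpd, mul_add, Finset.sum_add_distrib]

end Tensor

/-! ### Matrix inner products and ridge regression -/

open Tensor

/-- The Frobenius inner product of matrices. -/
def matInn {m n : Type*} [Fintype m] [Fintype n] (A B : Matrix m n ℝ) : ℝ :=
  ∑ i, ∑ j, A i j * B i j

theorem matInn_eq_trace {m n : Type*} [Fintype m] [Fintype n] (A B : Matrix m n ℝ) :
    matInn A B = (A * B.transpose).trace := by
  simp [matInn, Matrix.trace, Matrix.mul_apply]

theorem matInn_mul_right {m n p : Type*} [Fintype m] [Fintype n] [Fintype p]
    (A : Matrix m n ℝ) (B : Matrix m p ℝ) (C : Matrix p n ℝ) :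
    matInn A (B * C) = matInn (A * C.transpose) B := by
  simp [matInn_eq_trace, Matrix.transpose_mul, Matrix.mul_assoc]

theorem matInn_mul_left {m n p : Type*} [Fintype m] [Fintype n] [Fintype p]
    (A : Matrix m n ℝ) (B : Matrix m p ℝ) (C : Matrix p n ℝ) :
    matInn A (B * C) = matInn (B.transpose * A) C := by
  rw [matInn_eq_trace, matInn_eq_trace, Matrix.transpose_mul, Matrix.mul_assoc,
    ← Matrix.mul_assoc A, Matrix.trace_mul_comm B.transpose]

theorem matFrobSq_add {I J : ℕ} (A B : Matrix (Fin I) (Fin J) ℝ) :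
    matFrobSq (A + B) = matFrobSq A + 2 * matInn A B + matFrobSq B := by
  simp only [matFrobSq, matInn, Finset.mul_sum, ← Finset.sum_add_distrib, Matrix.add_apply]
  refine Finset.sum_congr rfl fun i _ => Finset.sum_congr rfl fun j _ => ?_
  ring

theorem matFrobSq_nonneg {I J : ℕ} (A : Matrix (Fin I) (Fin J) ℝ) : 0 ≤ matFrobSq A := by
  unfold matFrobSq; positivity

theorem sq_le_matFrobSq {I J : ℕ} (A : Matrix (Fin I) (Fin J) ℝ) (i : Fin I) (j : Fin J) :
    A i j ^ 2 ≤ matFrobSq A := by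
  unfold matFrobSq
  refine le_trans ?_ (Finset.single_le_sum (f := fun i => ∑ j, A i j ^ 2)
    (fun _ _ => by positivity) (Finset.mem_univ i))
  exact Finset.single_le_sum (f := fun j => A i j ^ 2)
    (fun _ _ => by positivity) (Finset.mem_univ j)

/-- The normal equation of ridge regression, tested against a matrix `H`. -/
theorem ridge_normal {m n p : Type*} [Fintype m] [Fintype n] [Fintype p] [DecidableEq p]
    (Z : Matrix m n ℝ) (K : Matrix n p ℝ) {c : ℝ} (hc : 0 < c) (H : Matrix m p ℝ) :
    matInn (Z - Z * K * (K.transpose * K + c • 1)⁻¹ * K.transpose) (H * K.transpose)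
      = c * matInn (Z * K * (K.transpose * K + c • 1)⁻¹) H := by
  -- The ridge term makes the matrix positive definite, so `⁻¹` is a genuine inverse.
  have hpd : (K.transpose * K + c • (1 : Matrix p p ℝ)).PosDef := by
    have h1 : (K.transpose * K).PosSemidef := by
      simpa [Matrix.conjTranspose_eq_transpose_of_trivial] using
        Matrix.posSemidef_conjTranspose_mul_self K
    exact Matrix.PosDef.posSemidef_add h1 (Matrix.PosDef.one.smul hc)
  have hu : IsUnit (K.transpose * K + c • (1 : Matrix p p ℝ)).det :=
    hpd.det_pos.ne'.isUnit
  set G := K.transpose * K + c • (1 : Matrix p p ℝ) with hG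
  set B := Z * K * G⁻¹ with hB
  have hBG : B * G = Z * K := by
    rw [hB, Matrix.mul_assoc, Matrix.nonsing_inv_mul _ hu, Matrix.mul_one]
  clear_value B
  -- The normal equation in matrix form; the claim follows by moving `Kᵀ` across the inner product.
  have hkey : (Z - B * K.transpose) * K = c • B := by
    have : B * G = B * K.transpose * K + c • B := by
      rw [hG, Matrix.mul_add, Matrix.mul_smul, Matrix.mul_one, Matrix.mul_assoc]
    rw [Matrix.sub_mul, ← hBG, this]; abel
  rw [matInn_mul_right, Matrix.transpose_transpose, hkey]
  simp [matInn, Finset.mul_sum, mul_assoc]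

/-- The sum over index pairs factorizes. This is why the small matrix `gram` is the regularized Gram
matrix of a Khatri-Rao design. -/
theorem khatriRao_transpose_mul_self {I J N : ℕ} (A : Matrix (Fin I) (Fin N) ℝ)
    (B : Matrix (Fin J) (Fin N) ℝ) :
    (khatriRao A B).transpose * khatriRao A B
      = Matrix.hadamard (A.transpose * A) (B.transpose * B) := by
  ext r s
  simp only [khatriRao, Matrix.mul_apply, Matrix.hadamard_apply, Matrix.transpose_apply,
    Matrix.of_apply, Fintype.sum_prod_type, Finset.sum_mul_sum]
  exact Finset.sum_congr rfl fun i _ => Finset.sum_congr rfl fun j _ => by ring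

/-! ### Unfoldings of the CPD and adjoints -/

namespace Tensor

variable {I J K N : ℕ}

/-- With two factors fixed, the CPD is linear in the third, with a Khatri-Rao design matrix; this
turns the block problem into a ridge regression. -/
theorem unfoldOne_cpd (A : Matrix (Fin I) (Fin N) ℝ) (B : Matrix (Fin J) (Fin N) ℝ)
    (C : Matrix (Fin K) (Fin N) ℝ) :
    (cpd A B C).unfoldOne = A * (khatriRao C B).transpose := by
  ext i c
  simp only [unfoldOne, cpd, khatriRao, Matrix.mul_apply, Matrix.transpose_apply, Matrix.of_apply]
  exact Finset.sum_congr rfl fun r _ => by ring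

theorem unfoldTwo_cpd (A : Matrix (Fin I) (Fin N) ℝ) (B : Matrix (Fin J) (Fin N) ℝ)
    (C : Matrix (Fin K) (Fin N) ℝ) :
    (cpd A B C).unfoldTwo = B * (khatriRao C A).transpose := by
  ext i c
  simp only [unfoldTwo, cpd, khatriRao, Matrix.mul_apply, Matrix.transpose_apply, Matrix.of_apply]
  exact Finset.sum_congr rfl fun r _ => by ring

theorem unfoldThree_cpd (A : Matrix (Fin I) (Fin N) ℝ) (B : Matrix (Fin J) (Fin N) ℝ)
    (C : Matrix (Fin K) (Fin N) ℝ) :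
    (cpd A B C).unfoldThree = C * (khatriRao B A).transpose := by
  ext i c
  simp only [unfoldThree, cpd, khatriRao, Matrix.mul_apply, Matrix.transpose_apply,
    Matrix.of_apply]
  exact Finset.sum_congr rfl fun r _ => by ring

theorem inn_unfoldOne (X Y : Tensor I J K) : X.inn Y = matInn X.unfoldOne Y.unfoldOne := by
  simp only [inn, matInn, unfoldOne, Matrix.of_apply, Fintype.sum_prod_type]
  exact Finset.sum_congr rfl fun i _ => Finset.sum_comm

/-- The adjoint of the `1`-mode product with `B` is the `1`-mode product with `Bᵀ`. -/
theorem inn_modeOne {I' : ℕ} (X : Tensor I' J K) (Y : Tensor I J K)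
    (B : Matrix (Fin I') (Fin I) ℝ) :
    X.inn (Y.modeOne B) = (X.modeOne B.transpose).inn Y := by
  have h (L L' : ℕ) (Z : Tensor L J K) (C : Matrix (Fin L') (Fin L) ℝ) :
      (Z.modeOne C).unfoldOne = C * Z.unfoldOne := by
    ext i c
    simp [modeOne, unfoldOne, Matrix.mul_apply]
  rw [inn_unfoldOne, inn_unfoldOne, h, h, matInn_mul_left]

theorem inn_unfoldTwo (X Y : Tensor I J K) : X.inn Y = matInn X.unfoldTwo Y.unfoldTwo := by
  simp only [inn, matInn, unfoldTwo, Matrix.of_apply, Fintype.sum_prod_type]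
  rw [Finset.sum_comm]
  exact Finset.sum_congr rfl fun j _ => Finset.sum_comm

theorem inn_unfoldThree (X Y : Tensor I J K) :
    X.inn Y = matInn X.unfoldThree Y.unfoldThree := by
  simp only [inn, matInn, unfoldThree, Matrix.of_apply, Fintype.sum_prod_type]
  rw [Finset.sum_congr rfl fun i _ => Finset.sum_comm, Finset.sum_comm]
  exact Finset.sum_congr rfl fun j _ => Finset.sum_comm

end Tensor

/-! ### Normal equations of the factor updates -/

namespace AugData

variable {E F T₁ T₂ N : ℕ} (D : AugData E F T₁ T₂)

/-- The factor `P` satisfies the normal equation of its block problem. -/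
def NormalP (X : Tensor E T₁ T₂) (P : Matrix (Fin E) (Fin N) ℝ)
    (Q₁ : Matrix (Fin T₁) (Fin N) ℝ) (Q₂ : Matrix (Fin T₂) (Fin N) ℝ) : Prop :=
  ∀ H, D.nu * (X - cpd P Q₁ Q₂).inn (cpd H Q₁ Q₂) = D.lam * matInn P H

/-- The factor `Q₁` satisfies the normal equation of its block problem. -/
def NormalQ₁ (X : Tensor E T₁ T₂) (P : Matrix (Fin E) (Fin N) ℝ)
    (Q₁ : Matrix (Fin T₁) (Fin N) ℝ) (Q₂ : Matrix (Fin T₂) (Fin N) ℝ) : Prop :=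
  ∀ H, D.nu * (X - cpd P Q₁ Q₂).inn (cpd P H Q₂) = D.lam * matInn Q₁ H

/-- The factor `Q₂` satisfies the normal equation of its block problem. -/
def NormalQ₂ (X : Tensor E T₁ T₂) (P : Matrix (Fin E) (Fin N) ℝ)
    (Q₁ : Matrix (Fin T₁) (Fin N) ℝ) (Q₂ : Matrix (Fin T₂) (Fin N) ℝ) : Prop :=
  ∀ H, D.nu * (X - cpd P Q₁ Q₂).inn (cpd P Q₁ H) = D.lam * matInn Q₂ H

theorem gram_eq {I J : ℕ} (B : Matrix (Fin I) (Fin N) ℝ) (C : Matrix (Fin J) (Fin N) ℝ) :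
    D.gram B C
      = (khatriRao C B).transpose * khatriRao C B + (D.lam / D.nu) • 1 := by
  rw [khatriRao_transpose_mul_self, gram, Matrix.hadamard_comm]

variable {D}

/-- Ridge regression of the unfolding with parameter `λ / ν`, multiplied by `ν`. -/
theorem normalP_pUpdate (hlam : 0 < D.lam) (hnu : 0 < D.nu) (X : Tensor E T₁ T₂)
    (Q₁ : Matrix (Fin T₁) (Fin N) ℝ) (Q₂ : Matrix (Fin T₂) (Fin N) ℝ) :
    D.NormalP X (D.pUpdate X Q₁ Q₂) Q₁ Q₂ := by
  intro H
  have h := ridge_normal X.unfoldOne (khatriRao Q₂ Q₁) (div_pos hlam hnu) H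
  rw [← gram_eq, ← unfoldOne_cpd, ← unfoldOne_cpd] at h
  have h2 : (X - cpd (D.pUpdate X Q₁ Q₂) Q₁ Q₂).unfoldOne
    = X.unfoldOne - (cpd (D.pUpdate X Q₁ Q₂) Q₁ Q₂).unfoldOne := rfl
  rw [inn_unfoldOne, h2]
  unfold pUpdate
  rw [h]
  field_simp

theorem normalQ₁_q₁Update (hlam : 0 < D.lam) (hnu : 0 < D.nu) (X : Tensor E T₁ T₂)
    (P : Matrix (Fin E) (Fin N) ℝ) (Q₂ : Matrix (Fin T₂) (Fin N) ℝ) :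
    D.NormalQ₁ X P (D.q₁Update X P Q₂) Q₂ := by
  intro H
  have h := ridge_normal X.unfoldTwo (khatriRao Q₂ P) (div_pos hlam hnu) H
  rw [← gram_eq, ← unfoldTwo_cpd, ← unfoldTwo_cpd] at h
  have h2 : (X - cpd P (D.q₁Update X P Q₂) Q₂).unfoldTwo
    = X.unfoldTwo - (cpd P (D.q₁Update X P Q₂) Q₂).unfoldTwo := rfl
  rw [inn_unfoldTwo, h2]
  unfold q₁Update
  rw [h]
  field_simp

theorem normalQ₂_q₂Update (hlam : 0 < D.lam) (hnu : 0 < D.nu) (X : Tensor E T₁ T₂)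
    (P : Matrix (Fin E) (Fin N) ℝ) (Q₁ : Matrix (Fin T₁) (Fin N) ℝ) :
    D.NormalQ₂ X P Q₁ (D.q₂Update X P Q₁) := by
  intro H
  have h := ridge_normal X.unfoldThree (khatriRao Q₁ P) (div_pos hlam hnu) H
  rw [← gram_eq, ← unfoldThree_cpd, ← unfoldThree_cpd] at h
  have h2 : (X - cpd P Q₁ (D.q₂Update X P Q₁)).unfoldThree
    = X.unfoldThree - (cpd P Q₁ (D.q₂Update X P Q₁)).unfoldThree := rfl
  rw [inn_unfoldThree, h2]
  unfold q₂Update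
  rw [h]
  field_simp

end AugData

/-! ### Soft-thresholding -/

theorem softThreshold_eq {μ : ℝ} (hμ : 0 ≤ μ) (x : ℝ) :
    softThreshold μ x = max (x - μ) 0 - max (-x - μ) 0 := by
  unfold softThreshold
  rcases lt_trichotomy x 0 with h | rfl | h
  · rw [Real.sign_of_neg h, abs_of_neg h, max_eq_right (a := x - μ) (by linarith)]; ring
  · simp
  · rw [Real.sign_of_pos h, abs_of_pos h, max_eq_right (a := -x - μ) (by linarith)]; ring

/-- Together with `sub_softThreshold_mul`, this says that `x - S_μ(x)` is a subgradient of `μ |·|`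
at `S_μ(x)`. -/
theorem abs_sub_softThreshold_le {μ : ℝ} (hμ : 0 ≤ μ) (x : ℝ) :
    |x - softThreshold μ x| ≤ μ := by
  rw [softThreshold_eq hμ, abs_le]
  constructor <;> rcases max_cases (x - μ) 0 with h | h <;>
    rcases max_cases (-x - μ) 0 with h' | h' <;> linarith

theorem sub_softThreshold_mul {μ : ℝ} (hμ : 0 ≤ μ) (x : ℝ) :
    (x - softThreshold μ x) * softThreshold μ x = μ * |softThreshold μ x| := by
  rw [softThreshold_eq hμ]
  rcases max_cases (x - μ) 0 with h | h <;> rcases max_cases (-x - μ) 0 with h' | h' <;>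
    rw [h.1, h'.1]
  -- Both positive parts can be active only if `x = μ = 0`.
  · have : x = 0 := by linarith
    have : μ = 0 := by linarith
    simp [*]
  · rw [abs_of_nonneg (by linarith)]; ring
  · rw [abs_of_nonpos (by linarith)]; ring
  · simp

/-- The variational inequality satisfied by the minimizer `S_μ(c) / g` of
`g a² / 2 - c a + μ |a|`. -/
theorem softThreshold_div_le {μ g c : ℝ} (hμ : 0 ≤ μ) (hg : 0 ≤ g) (h0 : g = 0 → c = 0) (w : ℝ) :
    (c - g * (softThreshold μ c / g)) * (w - softThreshold μ c / g)
      ≤ μ * |w| - μ * |softThreshold μ c / g| := by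
  rcases hg.eq_or_lt with rfl | hg
  -- Here `c = 0` and division by zero returns `0`, so what remains is `0 ≤ μ |w|`.
  · simp [h0 rfl]; positivity
  · have h1 := sub_softThreshold_mul hμ c
    have h2 := abs_sub_softThreshold_le hμ c
    set s := softThreshold μ c
    rw [mul_div_cancel₀ _ hg.ne', mul_sub]
    have h3 : (c - s) * w ≤ μ * |w| :=
      (le_abs_self _).trans (by rw [abs_mul]; gcongr)
    have h4 : (c - s) * (s / g) = μ * |s / g| := by
      rw [abs_div, abs_of_pos hg, ← mul_div_assoc, h1, mul_div_assoc]
    linarith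

/-! ### Optimality of the `X̃`-updates -/

namespace AugData

variable {E F T₁ T₂ N : ℕ} (D : AugData E F T₁ T₂)

/-- The gradient in `X` of the data fidelity term. -/
def dataGrad (X : Tensor E T₁ T₂) (A : Tensor F T₁ T₂) : Tensor E T₁ T₂ :=
  D.maskW ^ 2 * (X + A.modeOne D.R - D.Y)

/-- The first-order optimality condition of the block problem of `X` over the set `S`. -/
def XVarIneq (S : Set (Tensor E T₁ T₂)) (X : Tensor E T₁ T₂) (P : Matrix (Fin E) (Fin N) ℝ)
    (Q₁ : Matrix (Fin T₁) (Fin N) ℝ) (Q₂ : Matrix (Fin T₂) (Fin N) ℝ)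
    (A : Tensor F T₁ T₂) : Prop :=
  ∀ V ∈ S, 0 ≤ (D.dataGrad X A + D.nu • (X - cpd P Q₁ Q₂)).inn (V - X)

/-- Rewrites the gradient pairing as the cross term that appears when `frobSq_add` expands the
perturbed residual. -/
theorem inn_dataGrad (X V : Tensor E T₁ T₂) (A : Tensor F T₁ T₂) :
    (D.dataGrad X A).inn V
      = (D.maskW * (D.Y - X - A.modeOne D.R)).inn (-(D.maskW * V)) := by
  simp only [inn, dataGrad, Pi.mul_apply, Pi.sub_apply, Pi.add_apply, Pi.neg_apply, Pi.pow_apply]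
  refine Finset.sum_congr rfl fun i _ => Finset.sum_congr rfl fun j _ =>
    Finset.sum_congr rfl fun k _ => ?_
  ring

variable {D}

theorem xVarIneq_xUpdate (hnu : 0 < D.nu) (P : Matrix (Fin E) (Fin N) ℝ)
    (Q₁ : Matrix (Fin T₁) (Fin N) ℝ) (Q₂ : Matrix (Fin T₂) (Fin N) ℝ) (A : Tensor F T₁ T₂) :
    D.XVarIneq Set.univ (D.xUpdate P Q₁ Q₂ A) P Q₁ Q₂ A := by
  intro V _
  refine Finset.sum_nonneg fun i _ => Finset.sum_nonneg fun j _ => Finset.sum_nonneg fun k _ => ?_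
  have h : D.maskW i j k ^ 2 + D.nu ≠ 0 := by positivity
  simp only [dataGrad, xUpdate, Pi.mul_apply, Pi.sub_apply, Pi.add_apply, Pi.pow_apply,
    Pi.smul_apply, smul_eq_mul]
  -- Without a constraint the gradient vanishes entrywise.
  apply le_of_eq
  field_simp
  ring

theorem xVarIneq_xUpdateNonneg (hnu : 0 < D.nu) (P : Matrix (Fin E) (Fin N) ℝ)
    (Q₁ : Matrix (Fin T₁) (Fin N) ℝ) (Q₂ : Matrix (Fin T₂) (Fin N) ℝ) (A : Tensor F T₁ T₂) :
    D.XVarIneq {X | ∀ i j k, 0 ≤ X i j k} (D.xUpdateNonneg P Q₁ Q₂ A) P Q₁ Q₂ A := by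
  intro V hV
  refine Finset.sum_nonneg fun i _ => Finset.sum_nonneg fun j _ => Finset.sum_nonneg fun k _ => ?_
  have h : 0 < D.maskW i j k ^ 2 + D.nu := by positivity
  have hu : (D.maskW i j k ^ 2 + D.nu) * D.xUpdate P Q₁ Q₂ A i j k
      = D.maskW i j k ^ 2 * (D.Y i j k - A.modeOne D.R i j k) + D.nu * cpd P Q₁ Q₂ i j k := by
    rw [xUpdate]; field_simp
  have hv := hV i j k
  simp only [dataGrad, xUpdateNonneg, Pi.mul_apply, Pi.sub_apply, Pi.add_apply, Pi.pow_apply,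
    Pi.smul_apply, smul_eq_mul]
  set u := D.xUpdate P Q₁ Q₂ A i j k
  -- The problem separates into scalar quadratics with minimizer `u`. The gradient is nonzero only
  -- where `u < 0`; there the projected value is `0`, and both the gradient and `V` are nonnegative.
  have h1 : D.maskW i j k ^ 2 * (max u 0 + A.modeOne D.R i j k - D.Y i j k)
      + D.nu * (max u 0 - cpd P Q₁ Q₂ i j k)
      = (D.maskW i j k ^ 2 + D.nu) * (max u 0 - u) := by linear_combination hu
  rw [h1]
  rcases max_cases u 0 with h' | h' <;> rw [h'.1]
  · simp
  · exact mul_nonneg (mul_nonneg h.le (by linarith)) (by linarith)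

/-! ### Sufficient decrease in the strongly convex blocks -/

theorem fAug_nonneg (hlam : 0 < D.lam) (hnu : 0 < D.nu)
    (z : AugState E F T₁ T₂ N) : 0 ≤ D.fAug z := by
  obtain ⟨X, P, Q₁, Q₂, A⟩ := z
  have h1 := (D.maskW * (D.Y - X - A.modeOne D.R)).frobSq_nonneg
  have h2 := (X - cpd P Q₁ Q₂).frobSq_nonneg
  have h3 := (D.M * A).l1_nonneg
  have h4 := matFrobSq_nonneg P
  have h5 := matFrobSq_nonneg Q₁
  have h6 := matFrobSq_nonneg Q₂
  unfold fAug
  positivity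

/-- The objective is quadratic in `X`. The linear term at `X` is nonnegative by the variational
inequality, and the `ν`-term alone supplies the curvature. -/
theorem fAug_x_descent {S : Set (Tensor E T₁ T₂)} {X X₀ : Tensor E T₁ T₂}
    {P : Matrix (Fin E) (Fin N) ℝ} {Q₁ : Matrix (Fin T₁) (Fin N) ℝ}
    {Q₂ : Matrix (Fin T₂) (Fin N) ℝ} {A : Tensor F T₁ T₂} (h : D.XVarIneq S X P Q₁ Q₂ A)
    (hX₀ : X₀ ∈ S) :
    D.fAug (X, P, Q₁, Q₂, A) + D.nu / 2 * (X₀ - X).frobSq ≤ D.fAug (X₀, P, Q₁, Q₂, A) := by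
  have h := h X₀ hX₀
  obtain ⟨V, rfl⟩ : ∃ V, X₀ = X + V := ⟨X₀ - X, by abel⟩
  rw [add_sub_cancel_left, inn_add_left, inn_smul_left, inn_dataGrad] at h
  have e1 : D.maskW * (D.Y - (X + V) - A.modeOne D.R)
      = D.maskW * (D.Y - X - A.modeOne D.R) + -(D.maskW * V) := by ring
  have e2 : X + V - cpd P Q₁ Q₂ = (X - cpd P Q₁ Q₂) + V := by abel
  have h3 := (-(D.maskW * V)).frobSq_nonneg
  simp only [fAug, e1, e2, frobSq_add, add_sub_cancel_left]
  linarith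

/-- The normal equation cancels the linear term; the regularizer supplies the curvature, and that of
the CPD term is discarded. -/
theorem fAug_p_descent (hnu : 0 < D.nu) {X : Tensor E T₁ T₂}
    {P : Matrix (Fin E) (Fin N) ℝ} {Q₁ : Matrix (Fin T₁) (Fin N) ℝ}
    {Q₂ : Matrix (Fin T₂) (Fin N) ℝ} (h : D.NormalP X P Q₁ Q₂) (P₀ : Matrix (Fin E) (Fin N) ℝ)
    (A : Tensor F T₁ T₂) :
    D.fAug (X, P, Q₁, Q₂, A) + D.lam / 2 * matFrobSq (P₀ - P) ≤ D.fAug (X, P₀, Q₁, Q₂, A) := by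
  obtain ⟨V, rfl⟩ : ∃ V, P₀ = P + V := ⟨P₀ - P, by abel⟩
  have h := h V
  have e2 : X - (cpd P Q₁ Q₂ + cpd V Q₁ Q₂) = (X - cpd P Q₁ Q₂) + -cpd V Q₁ Q₂ := by abel
  have h3 := mul_nonneg hnu.le (cpd V Q₁ Q₂).frobSq_nonneg
  simp only [fAug, cpd_add_one, e2, frobSq_add, frobSq_neg, inn_neg_right, add_sub_cancel_left,
    matFrobSq_add]
  linarith

theorem fAug_q₁_descent (hnu : 0 < D.nu) {X : Tensor E T₁ T₂}
    {P : Matrix (Fin E) (Fin N) ℝ} {Q₁ : Matrix (Fin T₁) (Fin N) ℝ}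
    {Q₂ : Matrix (Fin T₂) (Fin N) ℝ} (h : D.NormalQ₁ X P Q₁ Q₂)
    (Q₁₀ : Matrix (Fin T₁) (Fin N) ℝ) (A : Tensor F T₁ T₂) :
    D.fAug (X, P, Q₁, Q₂, A) + D.lam / 2 * matFrobSq (Q₁₀ - Q₁)
      ≤ D.fAug (X, P, Q₁₀, Q₂, A) := by
  obtain ⟨V, rfl⟩ : ∃ V, Q₁₀ = Q₁ + V := ⟨Q₁₀ - Q₁, by abel⟩
  have h := h V
  have e2 : X - (cpd P Q₁ Q₂ + cpd P V Q₂) = (X - cpd P Q₁ Q₂) + -cpd P V Q₂ := by abel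
  have h3 := mul_nonneg hnu.le (cpd P V Q₂).frobSq_nonneg
  simp only [fAug, cpd_add_two, e2, frobSq_add, frobSq_neg, inn_neg_right, add_sub_cancel_left,
    matFrobSq_add]
  linarith

theorem fAug_q₂_descent (hnu : 0 < D.nu) {X : Tensor E T₁ T₂}
    {P : Matrix (Fin E) (Fin N) ℝ} {Q₁ : Matrix (Fin T₁) (Fin N) ℝ}
    {Q₂ : Matrix (Fin T₂) (Fin N) ℝ} (h : D.NormalQ₂ X P Q₁ Q₂)
    (Q₂₀ : Matrix (Fin T₂) (Fin N) ℝ) (A : Tensor F T₁ T₂) :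
    D.fAug (X, P, Q₁, Q₂, A) + D.lam / 2 * matFrobSq (Q₂₀ - Q₂)
      ≤ D.fAug (X, P, Q₁, Q₂₀, A) := by
  obtain ⟨V, rfl⟩ : ∃ V, Q₂₀ = Q₂ + V := ⟨Q₂₀ - Q₂, by abel⟩
  have h := h V
  have e2 : X - (cpd P Q₁ Q₂ + cpd P Q₁ V) = (X - cpd P Q₁ Q₂) + -cpd P Q₁ V := by abel
  have h3 := mul_nonneg hnu.le (cpd P Q₁ V).frobSq_nonneg
  simp only [fAug, cpd_add_three, e2, frobSq_add, frobSq_neg, inn_neg_right, add_sub_cancel_left,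
    matFrobSq_add]
  linarith

/-! ### Step size and decrease in `A` -/

theorem stepNum_eq (X : Tensor E T₁ T₂) (A' A₀ : Tensor F T₁ T₂) :
    D.stepNum X A' A₀ = (D.dataGrad X A₀).inn ((A' - A₀).modeOne D.R)
      + (D.M * A').l1 - (D.M * A₀).l1 := rfl

theorem stepDen_nonneg (A' A₀ : Tensor F T₁ T₂) : 0 ≤ D.stepDen A' A₀ := frobSq_nonneg _

theorem stepSize_mem (X : Tensor E T₁ T₂) (A' A₀ : Tensor F T₁ T₂) :
    D.stepSize X A' A₀ ∈ Set.Icc (0 : ℝ) 1 := by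
  unfold stepSize
  split_ifs
  · simp
  · simp
  · exact ⟨le_max_left _ _, max_le zero_le_one (min_le_left _ _)⟩

/-- The step size minimizes the majorizing function over `[0, 1]`. -/
theorem stepSize_le (X : Tensor E T₁ T₂) (A' A₀ : Tensor F T₁ T₂) {t : ℝ}
    (ht : t ∈ Set.Icc (0 : ℝ) 1) :
    D.stepSize X A' A₀ * D.stepNum X A' A₀ + D.stepSize X A' A₀ ^ 2 / 2 * D.stepDen A' A₀
      ≤ t * D.stepNum X A' A₀ + t ^ 2 / 2 * D.stepDen A' A₀ := by
  obtain ⟨ht0, ht1⟩ := ht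
  have hd := D.stepDen_nonneg A' A₀
  unfold stepSize
  split_ifs with h1 h2
  · rw [h1]; nlinarith
  · rw [h1]; push Not at h2; nlinarith
  · have hd : 0 < D.stepDen A' A₀ := lt_of_le_of_ne hd (Ne.symm h1)
    set d := D.stepDen A' A₀
    obtain ⟨q, hq⟩ : ∃ q, q = -(D.stepNum X A' A₀ / d) := ⟨_, rfl⟩
    have hn : D.stepNum X A' A₀ = -(q * d) := by rw [hq]; field_simp
    rw [← hq, hn]
    set γ := max 0 (min 1 q) with hγ
    -- The variational inequality of the projection `γ` of `q` onto `[0, 1]`. The gap between the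
    -- two quadratic values is `d * ((t - γ) * (γ - q) + (t - γ) ^ 2 / 2)`.
    have hvi : 0 ≤ (t - γ) * (γ - q) := by
      rcases le_total q 0 with h | h
      · have : γ = 0 := by rw [hγ]; exact max_eq_left ((min_le_right _ _).trans h)
        rw [this]; nlinarith
      · rcases le_total q 1 with h' | h'
        · have : γ = q := by rw [hγ, min_eq_right h', max_eq_right h]
          rw [this]; simp
        · have : γ = 1 := by rw [hγ, min_eq_left h']; simp
          rw [this]; nlinarith
    have h1 := mul_nonneg hd.le hvi
    have h2 := mul_nonneg hd.le (sq_nonneg (t - γ))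
    nlinarith

theorem l1_segment_le (B C : Tensor E T₁ T₂) {γ : ℝ} (hγ : γ ∈ Set.Icc (0 : ℝ) 1) :
    (B + γ • (C - B)).l1 ≤ B.l1 + γ * (C.l1 - B.l1) := by
  simp only [l1, mul_sub, Finset.mul_sum, ← Finset.sum_add_distrib, ← Finset.sum_sub_distrib]
  refine Finset.sum_le_sum fun i _ => Finset.sum_le_sum fun j _ => Finset.sum_le_sum fun k _ => ?_
  have e : (B + γ • (C - B)) i j k = (1 - γ) * B i j k + γ * C i j k := by
    simp only [Pi.add_apply, Pi.smul_apply, Pi.sub_apply, smul_eq_mul]; ring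
  rw [e]
  refine (abs_add_le _ _).trans_eq ?_
  rw [abs_mul, abs_mul, abs_of_nonneg hγ.1, abs_of_nonneg (by linarith [hγ.2])]
  ring

/-- The smooth part is exactly quadratic along the segment; only the `ℓ₁`-term is estimated, by its
chord. -/
theorem fAug_segment_le (X : Tensor E T₁ T₂)
    (P : Matrix (Fin E) (Fin N) ℝ) (Q₁ : Matrix (Fin T₁) (Fin N) ℝ)
    (Q₂ : Matrix (Fin T₂) (Fin N) ℝ) (A' A₀ : Tensor F T₁ T₂) {γ : ℝ}
    (hγ : γ ∈ Set.Icc (0 : ℝ) 1) :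
    D.fAug (X, P, Q₁, Q₂, A₀ + γ • (A' - A₀))
      ≤ D.fAug (X, P, Q₁, Q₂, A₀) + γ * D.stepNum X A' A₀ + γ ^ 2 / 2 * D.stepDen A' A₀ := by
  have e1 : D.maskW * (D.Y - X - (A₀ + γ • (A' - A₀)).modeOne D.R)
      = D.maskW * (D.Y - X - A₀.modeOne D.R) + -(D.maskW * (γ • (A' - A₀).modeOne D.R)) := by
    rw [modeOne_add, modeOne_smul]; ring
  have e2 : D.M * (A₀ + γ • (A' - A₀)) = D.M * A₀ + γ • (D.M * A' - D.M * A₀) := by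
    rw [mul_add, mul_smul_comm, mul_sub]
  have e3 : (D.dataGrad X A₀).inn (γ • (A' - A₀).modeOne D.R)
      = γ * (D.dataGrad X A₀).inn ((A' - A₀).modeOne D.R) := by
    simp only [inn, Finset.mul_sum, Pi.smul_apply, smul_eq_mul]
    refine Finset.sum_congr rfl fun i _ => Finset.sum_congr rfl fun j _ =>
      Finset.sum_congr rfl fun k _ => ?_
    ring
  have e4 : (D.maskW * (γ • (A' - A₀).modeOne D.R)).frobSq = γ ^ 2 * D.stepDen A' A₀ := by
    rw [mul_smul_comm, frobSq_smul]; rfl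
  have h := l1_segment_le (D.M * A₀) (D.M * A') hγ
  simp only [fAug, e1, e2, frobSq_add, ← inn_dataGrad, e3, frobSq_neg, e4, stepNum_eq]
  linarith

theorem fAug_a_descent (X : Tensor E T₁ T₂)
    (P : Matrix (Fin E) (Fin N) ℝ) (Q₁ : Matrix (Fin T₁) (Fin N) ℝ)
    (Q₂ : Matrix (Fin T₂) (Fin N) ℝ) (A' A₀ : Tensor F T₁ T₂) {t : ℝ}
    (ht : t ∈ Set.Icc (0 : ℝ) 1) :
    D.fAug (X, P, Q₁, Q₂, A₀ + D.stepSize X A' A₀ • (A' - A₀))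
      ≤ D.fAug (X, P, Q₁, Q₂, A₀) + (t * D.stepNum X A' A₀ + t ^ 2 / 2 * D.stepDen A' A₀) := by
  linarith [fAug_segment_le (D := D) X P Q₁ Q₂ A' A₀ (D.stepSize_mem X A' A₀),
    D.stepSize_le X A' A₀ ht]

/-! ### Best response and optimality in `A` -/

/-- The gradient in `A` of the data fidelity term. -/
def aGrad (D : AugData E F T₁ T₂) (X : Tensor E T₁ T₂) (A : Tensor F T₁ T₂) : Tensor F T₁ T₂ :=
  (D.dataGrad X A).modeOne D.R.transpose

theorem aDenom_nonneg (i : Fin F) (j : Fin T₁) (k : Fin T₂) : 0 ≤ D.aDenom i j k := by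
  unfold aDenom modeOne
  exact Finset.sum_nonneg fun e _ => mul_nonneg (sq_nonneg _) (sq_nonneg _)

/-- The denominator is a sum of squares of products of mask and routing entries. If it vanishes, so
does each product, and each is a factor of a term of the gradient. -/
theorem aGrad_eq_zero {i : Fin F} {j : Fin T₁} {k : Fin T₂} (h : D.aDenom i j k = 0)
    (X : Tensor E T₁ T₂) (A : Tensor F T₁ T₂) : D.aGrad X A i j k = 0 := by
  simp only [aDenom, modeOne, Matrix.of_apply, Pi.pow_apply] at h
  rw [Finset.sum_eq_zero_iff_of_nonneg
    (fun e _ => mul_nonneg (sq_nonneg _) (sq_nonneg _))] at h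
  unfold aGrad modeOne
  refine Finset.sum_eq_zero fun e he => ?_
  have := h e he
  rw [← mul_pow] at this
  have h0 := pow_eq_zero_iff (two_ne_zero) |>.1 this
  simp only [dataGrad, Matrix.transpose_apply, Pi.mul_apply, Pi.pow_apply]
  linear_combination (D.maskW e j k * (X + A.modeOne D.R - D.Y) e j k) * h0

theorem aBest_eq (X : Tensor E T₁ T₂) (A₀ : Tensor F T₁ T₂) (i : Fin F) (j : Fin T₁)
    (k : Fin T₂) :
    D.aBest X A₀ i j k = softThreshold (D.M i j k)
      (-D.aGrad X A₀ i j k + D.aDenom i j k * A₀ i j k) / D.aDenom i j k := by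
  have : (D.maskW ^ 2 * (D.Y - X - A₀.modeOne D.R)).modeOne D.R.transpose i j k
      = -D.aGrad X A₀ i j k := by
    simp only [aGrad, modeOne, dataGrad, ← Finset.sum_neg_distrib, Pi.mul_apply, Pi.sub_apply,
      Pi.add_apply]
    exact Finset.sum_congr rfl fun e _ => by ring
  rw [aBest, this]

theorem aBest_varIneq (hM : ∀ i t₁ t₂, 0 < D.M i t₁ t₂) (X : Tensor E T₁ T₂)
    (A₀ : Tensor F T₁ T₂) (i : Fin F) (j : Fin T₁) (k : Fin T₂) (w : ℝ) :
    (D.aDenom i j k * (A₀ i j k - D.aBest X A₀ i j k) - D.aGrad X A₀ i j k)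
        * (w - D.aBest X A₀ i j k)
      ≤ D.M i j k * |w| - D.M i j k * |D.aBest X A₀ i j k| := by
  have h := softThreshold_div_le (hM i j k).le (D.aDenom_nonneg i j k)
    (c := -D.aGrad X A₀ i j k + D.aDenom i j k * A₀ i j k)
    (fun h => by rw [aGrad_eq_zero h, h]; ring) w
  rw [← aBest_eq] at h
  refine le_trans (le_of_eq ?_) h
  ring

theorem l1_mul (hM : ∀ i t₁ t₂, 0 < D.M i t₁ t₂) (A : Tensor F T₁ T₂) :
    (D.M * A).l1 = ∑ i, ∑ j, ∑ k, D.M i j k * |A i j k| := by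
  unfold l1
  refine Finset.sum_congr rfl fun i _ => Finset.sum_congr rfl fun j _ =>
    Finset.sum_congr rfl fun k _ => ?_
  rw [Pi.mul_apply, Pi.mul_apply, Pi.mul_apply, abs_mul, abs_of_pos (hM i j k)]

theorem stepNum_eq_sum (hM : ∀ i t₁ t₂, 0 < D.M i t₁ t₂) (X : Tensor E T₁ T₂)
    (A' A₀ : Tensor F T₁ T₂) :
    D.stepNum X A' A₀ = ∑ i, ∑ j, ∑ k, (D.aGrad X A₀ i j k * (A' i j k - A₀ i j k)
      + D.M i j k * |A' i j k| - D.M i j k * |A₀ i j k|) := by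
  rw [stepNum_eq, inn_modeOne, l1_mul hM, l1_mul hM]
  simp only [Finset.sum_add_distrib, Finset.sum_sub_distrib]
  rfl

/-- If the step direction is not a descent direction of the majorizing function, then `A₀` is a
solution of its block problem. -/
theorem aGrad_varIneq (hM : ∀ i t₁ t₂, 0 < D.M i t₁ t₂) {X : Tensor E T₁ T₂}
    {A₀ : Tensor F T₁ T₂} (h : 0 ≤ D.stepNum X (D.aBest X A₀) A₀)
    (i : Fin F) (j : Fin T₁) (k : Fin T₂) (w : ℝ) :
    0 ≤ D.aGrad X A₀ i j k * (w - A₀ i j k) + D.M i j k * |w| - D.M i j k * |A₀ i j k| := by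
  -- Testing the best response against `w = A₀` makes every summand of the slope nonpositive, so a
  -- nonnegative slope forces all of them to vanish.
  have hle (i j k) : D.aGrad X A₀ i j k * (D.aBest X A₀ i j k - A₀ i j k)
      + D.M i j k * |D.aBest X A₀ i j k| - D.M i j k * |A₀ i j k|
      ≤ -(D.aDenom i j k * (A₀ i j k - D.aBest X A₀ i j k) ^ 2) := by
    have := aBest_varIneq hM X A₀ i j k (A₀ i j k)
    linarith
  have hnonpos (i j k) : D.aGrad X A₀ i j k * (D.aBest X A₀ i j k - A₀ i j k)
      + D.M i j k * |D.aBest X A₀ i j k| - D.M i j k * |A₀ i j k| ≤ 0 :=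
    (hle i j k).trans
      (neg_nonpos.2 (mul_nonneg (D.aDenom_nonneg i j k) (sq_nonneg _)))
  rw [stepNum_eq_sum hM] at h
  have h1 := le_antisymm (Finset.sum_nonpos fun i _ => Finset.sum_nonpos fun j _ =>
    Finset.sum_nonpos fun k _ => hnonpos i j k) h
  rw [Finset.sum_eq_zero_iff_of_nonpos fun i _ => Finset.sum_nonpos fun j _ =>
    Finset.sum_nonpos fun k _ => hnonpos i j k] at h1
  have h2 := h1 i (Finset.mem_univ i)
  rw [Finset.sum_eq_zero_iff_of_nonpos fun j _ =>
    Finset.sum_nonpos fun k _ => hnonpos i j k] at h2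
  have h3 := h2 j (Finset.mem_univ j)
  rw [Finset.sum_eq_zero_iff_of_nonpos fun k _ => hnonpos i j k] at h3
  have h4 := h3 k (Finset.mem_univ k)
  -- A positive denominator kills the squared difference. If the denominator is zero, the best
  -- response and the gradient are zero, the summand is `-M |A₀|`, and `M > 0` gives `A₀ = 0`.
  have heq : D.aBest X A₀ i j k = A₀ i j k := by
    rcases (D.aDenom_nonneg i j k).eq_or_lt with h0 | h0
    · have hb : D.aBest X A₀ i j k = 0 := by rw [aBest_eq, ← h0, div_zero]
      rw [hb, aGrad_eq_zero h0.symm] at h4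
      have : D.M i j k * |A₀ i j k| = 0 := by simpa using h4
      rw [hb]
      simpa [(hM i j k).ne', eq_comm] using this
    · have h5 := hle i j k
      rw [h4] at h5
      have h6 : (A₀ i j k - D.aBest X A₀ i j k) ^ 2 ≤ 0 := by nlinarith
      have h7 := pow_eq_zero_iff two_ne_zero |>.1 (le_antisymm h6 (sq_nonneg _))
      linarith
  have h8 := aBest_varIneq hM X A₀ i j k w
  rw [heq] at h8
  linarith

end AugData

/-! ### Continuity -/

section Continuity

variable {α : Type*} [TopologicalSpace α] {I J K N : ℕ}

@[fun_prop]
theorem Tensor.continuous_inn {f g : α → Tensor I J K} (hf : Continuous f) (hg : Continuous g) :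
    Continuous fun a => (f a).inn (g a) := by
  unfold inn; fun_prop

@[fun_prop]
theorem Tensor.continuous_frobSq {f : α → Tensor I J K} (hf : Continuous f) :
    Continuous fun a => (f a).frobSq := by
  unfold frobSq; fun_prop

@[fun_prop]
theorem Tensor.continuous_l1 {f : α → Tensor I J K} (hf : Continuous f) :
    Continuous fun a => (f a).l1 := by
  unfold l1; fun_prop

@[fun_prop]
theorem Tensor.continuous_modeOne {I' : ℕ} {f : α → Tensor I J K} (hf : Continuous f)
    (B : Matrix (Fin I') (Fin I) ℝ) : Continuous fun a => (f a).modeOne B := by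
  unfold modeOne; fun_prop

@[fun_prop]
theorem Tensor.continuous_cpd {f : α → Matrix (Fin I) (Fin N) ℝ} {g : α → Matrix (Fin J) (Fin N) ℝ}
    {h : α → Matrix (Fin K) (Fin N) ℝ} (hf : Continuous f) (hg : Continuous g)
    (hh : Continuous h) : Continuous fun a => cpd (f a) (g a) (h a) := by
  unfold cpd
  refine continuous_pi fun i => continuous_pi fun j => continuous_pi fun k =>
    continuous_finsetSum _ fun r _ => ?_
  exact ((hf.matrix_elem i r).mul (hg.matrix_elem j r)).mul (hh.matrix_elem k r)

@[fun_prop]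
theorem continuous_matInn {f g : α → Matrix (Fin I) (Fin J) ℝ} (hf : Continuous f)
    (hg : Continuous g) : Continuous fun a => matInn (f a) (g a) := by
  unfold matInn
  exact continuous_finsetSum _ fun i _ => continuous_finsetSum _ fun j _ =>
    (hf.matrix_elem i j).mul (hg.matrix_elem i j)

theorem continuous_softThreshold {μ : ℝ} (hμ : 0 ≤ μ) : Continuous (softThreshold μ) := by
  rw [funext (softThreshold_eq hμ)]
  fun_prop

end Continuity

/-! ### Limits from vanishing decrements -/

section Convergence

variable {I J K : ℕ}

theorem tendsto_of_sq_sub_le {a b g : ℕ → ℝ} {x c : ℝ} (hc : 0 < c)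
    (hb : Tendsto b atTop (𝓝 x)) (hg : Tendsto g atTop (𝓝 0))
    (h : ∀ n, c * (b n - a n) ^ 2 ≤ g n) : Tendsto a atTop (𝓝 x) := by
  have h1 : Tendsto (fun n => (b n - a n) ^ 2) atTop (𝓝 0) := by
    refine squeeze_zero (fun n => sq_nonneg _) (fun n => ?_) (by simpa using hg.div_const c)
    rw [le_div_iff₀ hc, mul_comm]
    exact h n
  have h2 : Tendsto (fun n => |b n - a n|) atTop (𝓝 0) := by
    simpa [Real.sqrt_sq_eq_abs] using h1.sqrt
  simpa using hb.sub ((tendsto_zero_iff_abs_tendsto_zero _).2 h2)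

theorem Tensor.tendsto_of_frobSq_sub_le {a b : ℕ → Tensor I J K} {g : ℕ → ℝ} {x : Tensor I J K}
    {c : ℝ} (hc : 0 < c) (hb : Tendsto b atTop (𝓝 x)) (hg : Tendsto g atTop (𝓝 0))
    (h : ∀ n, c * (b n - a n).frobSq ≤ g n) : Tendsto a atTop (𝓝 x) := by
  refine tendsto_pi_nhds.2 fun i => tendsto_pi_nhds.2 fun j => tendsto_pi_nhds.2 fun k => ?_
  refine tendsto_of_sq_sub_le hc (((hb.apply_nhds i).apply_nhds j).apply_nhds k) hg fun n => ?_
  exact (mul_le_mul_of_nonneg_left (sq_le_frobSq (b n - a n) i j k) hc.le).trans (h n)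

theorem tendsto_of_matFrobSq_sub_le {a b : ℕ → Matrix (Fin I) (Fin J) ℝ} {g : ℕ → ℝ}
    {x : Matrix (Fin I) (Fin J) ℝ} {c : ℝ} (hc : 0 < c) (hb : Tendsto b atTop (𝓝 x))
    (hg : Tendsto g atTop (𝓝 0)) (h : ∀ n, c * matFrobSq (b n - a n) ≤ g n) :
    Tendsto a atTop (𝓝 x) := by
  refine tendsto_pi_nhds.2 fun i => tendsto_pi_nhds.2 fun j => ?_
  refine tendsto_of_sq_sub_le hc ((Tendsto.apply_nhds hb i).apply_nhds j) hg fun n => ?_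
  exact (mul_le_mul_of_nonneg_left (sq_le_matFrobSq (b n - a n) i j) hc.le).trans (h n)

theorem tendsto_sub_succ_of_antitone {f : ℕ → ℝ} (hf : Antitone f) (h0 : ∀ n, 0 ≤ f n) :
    Tendsto (fun n => f n - f (n + 1)) atTop (𝓝 0) := by
  have h := tendsto_atTop_ciInf hf ⟨0, by rintro _ ⟨n, rfl⟩; exact h0 n⟩
  simpa using h.sub (h.comp (tendsto_add_atTop_nat 1))

end Convergence

/-! ### Derivatives along lines -/

section Derivatives

variable {I J K : ℕ}

theorem Tensor.hasDerivAt_frobSq {Z : ℝ → Tensor I J K} {Z' : Tensor I J K} {x : ℝ}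
    (h : ∀ i j k, HasDerivAt (fun t => Z t i j k) (Z' i j k) x) :
    HasDerivAt (fun t => (Z t).frobSq) (2 * (Z x).inn Z') x := by
  simp only [frobSq, inn, Finset.mul_sum]
  refine HasDerivAt.fun_sum fun i _ => HasDerivAt.fun_sum fun j _ =>
    HasDerivAt.fun_sum fun k _ => ?_
  refine ((h i j k).fun_pow 2).congr_deriv ?_
  push_cast; ring

theorem hasDerivAt_matFrobSq_line (A B : Matrix (Fin I) (Fin J) ℝ) :
    HasDerivAt (fun t : ℝ => matFrobSq (A + t • B)) (2 * matInn A B) 0 := by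
  simp only [matFrobSq, matInn, Finset.mul_sum]
  refine HasDerivAt.fun_sum fun i _ => HasDerivAt.fun_sum fun j _ => ?_
  have h : HasDerivAt (fun t : ℝ => (A + t • B) i j) (B i j) 0 := by
    simpa using ((hasDerivAt_id (0 : ℝ)).mul_const (B i j)).const_add (A i j)
  refine (h.fun_pow 2).congr_deriv ?_
  simp; ring

theorem Tensor.hasDerivAt_cpd_line {N : ℕ} (A A' : Matrix (Fin I) (Fin N) ℝ)
    (B B' : Matrix (Fin J) (Fin N) ℝ) (C C' : Matrix (Fin K) (Fin N) ℝ) (i : Fin I) (j : Fin J)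
    (k : Fin K) :
    HasDerivAt (fun t : ℝ => cpd (A + t • A') (B + t • B') (C + t • C') i j k)
      ((cpd A' B C + cpd A B' C + cpd A B C') i j k) 0 := by
  have h (a b : ℝ) : HasDerivAt (fun t : ℝ => a + t * b) b 0 := by
    simpa using ((hasDerivAt_id (0 : ℝ)).mul_const b).const_add a
  simp only [cpd, Pi.add_apply, ← Finset.sum_add_distrib]
  refine HasDerivAt.fun_sum fun r _ => ?_
  refine (((h (A i r) (A' i r)).fun_mul (h (B j r) (B' j r))).fun_mul
    (h (C k r) (C' k r))).congr_deriv ?_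
  simp; ring

/-- Only `a = 0` is delicate: there `|t * b| = t * |b|` for `t ≥ 0`, so the one-sided derivative
still exists. -/
theorem exists_hasDerivWithinAt_abs_line (a b : ℝ) :
    ∃ d, HasDerivWithinAt (fun t : ℝ => |a + t * b|) d (Set.Ici 0) 0 := by
  have h : HasDerivAt (fun t : ℝ => a + t * b) b 0 := by
    simpa using ((hasDerivAt_id (0 : ℝ)).mul_const b).const_add a
  rcases eq_or_ne a 0 with rfl | ha
  · refine ⟨|b|, ?_⟩
    have h2 : HasDerivWithinAt (fun t : ℝ => t * |b|) |b| (Set.Ici 0) 0 := by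
      simpa using ((hasDerivAt_id (0 : ℝ)).mul_const |b|).hasDerivWithinAt
    refine h2.congr (fun t ht => ?_) (by simp)
    rw [zero_add, abs_mul, abs_of_nonneg ht]
  · have h3 : a + 0 * b ≠ 0 := by simpa
    exact ⟨_, (HasDerivAt.comp (h₂ := fun x : ℝ => |x|) (0 : ℝ) (hasDerivAt_abs h3)
      h).hasDerivWithinAt⟩

theorem HasDerivWithinAt.nonneg_of_le {h : ℝ → ℝ} {d : ℝ}
    (hd : HasDerivWithinAt h d (Set.Ici 0) 0) (hle : ∀ t, 0 < t → h 0 ≤ h t) : 0 ≤ d := by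
  have h1 := (hasDerivWithinAt_iff_tendsto_slope' (by simp)).1 (hd.mono Set.Ioi_subset_Ici_self)
  refine ge_of_tendsto h1 ?_
  filter_upwards [self_mem_nhdsWithin] with t ht
  rw [slope_def_field]
  exact div_nonneg (sub_nonneg.2 (hle t ht)) (by simpa using (Set.mem_Ioi.1 ht).le)

end Derivatives

/-! ### Stationarity from blockwise optimality -/

namespace AugData

variable {E F T₁ T₂ N : ℕ} {D : AugData E F T₁ T₂}

theorem fAug_isStationaryOn (hM : ∀ i t₁ t₂, 0 < D.M i t₁ t₂) {S : Set (Tensor E T₁ T₂)}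
    {X : Tensor E T₁ T₂} {P : Matrix (Fin E) (Fin N) ℝ} {Q₁ : Matrix (Fin T₁) (Fin N) ℝ}
    {Q₂ : Matrix (Fin T₂) (Fin N) ℝ} {A : Tensor F T₁ T₂} (hXS : X ∈ S)
    (hX : D.XVarIneq S X P Q₁ Q₂ A) (hP : D.NormalP X P Q₁ Q₂) (hQ₁ : D.NormalQ₁ X P Q₁ Q₂)
    (hQ₂ : D.NormalQ₂ X P Q₁ Q₂) (hA : 0 ≤ D.stepNum X (D.aBest X A) A) :
    IsStationaryOn D.fAug {z : AugState E F T₁ T₂ N | z.1 ∈ S} (X, P, Q₁, Q₂, A) := by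
  refine ⟨hXS, ?_⟩
  rintro ⟨X', P', Q₁', Q₂', A'⟩ hX'
  have hX := hX X' hX'
  obtain ⟨U, hU⟩ : ∃ U, U = X' - X := ⟨_, rfl⟩
  obtain ⟨p, hp⟩ : ∃ p, p = P' - P := ⟨_, rfl⟩
  obtain ⟨q₁, hq₁⟩ : ∃ q, q = Q₁' - Q₁ := ⟨_, rfl⟩
  obtain ⟨q₂, hq₂⟩ : ∃ q, q = Q₂' - Q₂ := ⟨_, rfl⟩
  obtain ⟨B, hB⟩ : ∃ B, B = A' - A := ⟨_, rfl⟩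
  have hfun (t : ℝ) : D.fAug ((X, P, Q₁, Q₂, A) + t • ((X', P', Q₁', Q₂', A') - (X, P, Q₁, Q₂, A)))
      = 1 / 2 * (D.maskW * (D.Y - X - A.modeOne D.R)
            + t • -(D.maskW * (U + B.modeOne D.R))).frobSq
        + D.nu / 2 * (X + t • U - cpd (P + t • p) (Q₁ + t • q₁) (Q₂ + t • q₂)).frobSq
        + (∑ i, ∑ j, ∑ k, D.M i j k * |A i j k + t * B i j k|)
        + D.lam / 2 * (matFrobSq (P + t • p) + matFrobSq (Q₁ + t • q₁)
            + matFrobSq (Q₂ + t • q₂)) := by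
    have e : D.maskW * (D.Y - X - A.modeOne D.R) + t • -(D.maskW * (U + B.modeOne D.R))
        = D.maskW * (D.Y - (X + t • U) - (A + t • B).modeOne D.R) := by
      rw [modeOne_add, modeOne_smul]
      ext i j k
      simp only [Pi.mul_apply, Pi.sub_apply, Pi.add_apply, Pi.smul_apply, Pi.neg_apply,
        smul_eq_mul]
      ring
    rw [e, hU, hp, hq₁, hq₂, hB]
    exact congrArg₂ (· + ·) (congrArg₂ (· + ·) rfl (l1_mul hM _)) rfl
  have hline (a b : ℝ) : HasDerivAt (fun t : ℝ => a + t * b) b 0 := by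
    simpa using ((hasDerivAt_id (0 : ℝ)).mul_const b).const_add a
  have h1 := hasDerivAt_frobSq (x := 0) (fun i j k =>
    hline ((D.maskW * (D.Y - X - A.modeOne D.R)) i j k) ((-(D.maskW * (U + B.modeOne D.R))) i j k))
  have h2 := hasDerivAt_frobSq (x := 0)
    (Z := fun t : ℝ => X + t • U - cpd (P + t • p) (Q₁ + t • q₁) (Q₂ + t • q₂))
    (Z' := U - (cpd p Q₁ Q₂ + cpd P q₁ Q₂ + cpd P Q₁ q₂))
    (fun i j k => (hline (X i j k) (U i j k)).sub (hasDerivAt_cpd_line P p Q₁ q₁ Q₂ q₂ i j k))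
  -- The values of these derivatives are irrelevant; only the sign of their combination with the
  -- gradient matters.
  choose d hd using fun i j k => exists_hasDerivWithinAt_abs_line (A i j k) (B i j k)
  have h3 : HasDerivWithinAt (fun t : ℝ => ∑ i, ∑ j, ∑ k, D.M i j k * |A i j k + t * B i j k|)
      (∑ i, ∑ j, ∑ k, D.M i j k * d i j k) (Set.Ici 0) 0 :=
    HasDerivWithinAt.fun_sum fun i _ => HasDerivWithinAt.fun_sum fun j _ =>
      HasDerivWithinAt.fun_sum fun k _ => (hd i j k).const_mul _
  have h4 := ((hasDerivAt_matFrobSq_line P p).fun_add (hasDerivAt_matFrobSq_line Q₁ q₁)).fun_add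
    (hasDerivAt_matFrobSq_line Q₂ q₂)
  have hall := (((h1.const_mul (1 / 2)).fun_add (h2.const_mul (D.nu / 2))).hasDerivWithinAt.fun_add
    h3).fun_add (h4.const_mul (D.lam / 2)).hasDerivWithinAt
  refine ⟨_, ?_, hall.congr (fun t _ => hfun t) (hfun 0)⟩
  have hA' : 0 ≤ (D.aGrad X A).inn B + ∑ i, ∑ j, ∑ k, D.M i j k * d i j k := by
    simp only [inn, ← Finset.sum_add_distrib]
    refine Finset.sum_nonneg fun i _ => Finset.sum_nonneg fun j _ =>
      Finset.sum_nonneg fun k _ => ?_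
    -- By `aGrad_varIneq`, the scalar function `t ↦ g t b + M |a + t b|` is minimal at `t = 0`,
    -- where `g` is the entry of `aGrad`.
    refine HasDerivWithinAt.nonneg_of_le (((hline 0 (B i j k)).hasDerivWithinAt.const_mul
      (D.aGrad X A i j k)).fun_add ((hd i j k).const_mul (D.M i j k))) fun t _ => ?_
    have := aGrad_varIneq hM hA i j k (A i j k + t * B i j k)
    simp only [zero_mul, add_zero, mul_zero, zero_add, add_sub_cancel_left] at this ⊢
    linarith
  have hin : ((D.maskW * (D.Y - X - A.modeOne D.R)).inn (-(D.maskW * (U + B.modeOne D.R))))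
      = (D.dataGrad X A).inn U + (D.aGrad X A).inn B := by
    rw [← inn_dataGrad, inn_add_right, inn_modeOne, aGrad]
  rw [← hU, inn_add_left, inn_smul_left] at hX
  have hP := hP p
  have hQ₁ := hQ₁ q₁
  have hQ₂ := hQ₂ q₂
  have e1 : (fun i j k => (D.maskW * (D.Y - X - A.modeOne D.R)) i j k
      + 0 * (-(D.maskW * (U + B.modeOne D.R))) i j k : Tensor E T₁ T₂)
      = D.maskW * (D.Y - X - A.modeOne D.R) := by
    ext i j k; simp
  simp only [e1, hin, zero_smul, add_zero]
  rw [sub_eq_add_neg U, inn_add_right, inn_neg_right, inn_add_right, inn_add_right]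
  linarith

/-- What one iteration guarantees: the optimality conditions of the block updates and the
decrease of the objective. -/
theorem step_spec (hlam : 0 < D.lam) (hnu : 0 < D.nu) {S : Set (Tensor E T₁ T₂)}
    {upd : Matrix (Fin E) (Fin N) ℝ → Matrix (Fin T₁) (Fin N) ℝ →
      Matrix (Fin T₂) (Fin N) ℝ → Tensor F T₁ T₂ → Tensor E T₁ T₂}
    (hmem : ∀ P Q₁ Q₂ A, upd P Q₁ Q₂ A ∈ S)
    (hvi : ∀ P Q₁ Q₂ A, D.XVarIneq S (upd P Q₁ Q₂ A) P Q₁ Q₂ A)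
    (X₀ : Tensor E T₁ T₂) (P₀ : Matrix (Fin E) (Fin N) ℝ) (Q₁₀ : Matrix (Fin T₁) (Fin N) ℝ)
    (Q₂₀ : Matrix (Fin T₂) (Fin N) ℝ) (A₀ : Tensor F T₁ T₂) (hX₀ : X₀ ∈ S)
    (w : AugState E F T₁ T₂ N) (hw : w = D.step upd (P₀, Q₁₀, Q₂₀, A₀)) :
    w.1 ∈ S ∧ ∃ X', D.XVarIneq S X' P₀ Q₁₀ Q₂₀ A₀ ∧ D.NormalP X' w.2.1 Q₁₀ Q₂₀ ∧
      D.NormalQ₁ X' w.2.1 w.2.2.1 Q₂₀ ∧ D.NormalQ₂ X' w.2.1 w.2.2.1 w.2.2.2.1 ∧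
      ∀ t ∈ Set.Icc (0 : ℝ) 1, D.fAug w + D.nu / 2 * (X₀ - X').frobSq
          + D.lam / 2 * matFrobSq (P₀ - w.2.1) + D.lam / 2 * matFrobSq (Q₁₀ - w.2.2.1)
          + D.lam / 2 * matFrobSq (Q₂₀ - w.2.2.2.1) + D.nu / 2 * (X' - w.1).frobSq
        ≤ D.fAug (X₀, P₀, Q₁₀, Q₂₀, A₀) + (t * D.stepNum w.1 (D.aBest w.1 A₀) A₀
          + t ^ 2 / 2 * D.stepDen (D.aBest w.1 A₀) A₀) := by
  obtain ⟨X', hX'⟩ : ∃ X', X' = upd P₀ Q₁₀ Q₂₀ A₀ := ⟨_, rfl⟩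
  obtain ⟨P, hP⟩ : ∃ P, P = D.pUpdate X' Q₁₀ Q₂₀ := ⟨_, rfl⟩
  obtain ⟨Q₁, hQ₁⟩ : ∃ Q₁, Q₁ = D.q₁Update X' P Q₂₀ := ⟨_, rfl⟩
  obtain ⟨Q₂, hQ₂⟩ : ∃ Q₂, Q₂ = D.q₂Update X' P Q₁ := ⟨_, rfl⟩
  obtain ⟨X, hX⟩ : ∃ X, X = upd P Q₁ Q₂ A₀ := ⟨_, rfl⟩
  have hw' : w = (X, P, Q₁, Q₂,
      A₀ + D.stepSize X (D.aBest X A₀) A₀ • (D.aBest X A₀ - A₀)) := by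
    rw [hw, step]
    simp only [← hX', ← hP, ← hQ₁, ← hQ₂, ← hX]
  have vX' : D.XVarIneq S X' P₀ Q₁₀ Q₂₀ A₀ := hX' ▸ hvi _ _ _ _
  have vX : D.XVarIneq S X P Q₁ Q₂ A₀ := hX ▸ hvi _ _ _ _
  have mX' : X' ∈ S := hX' ▸ hmem _ _ _ _
  have nP : D.NormalP X' P Q₁₀ Q₂₀ := hP ▸ normalP_pUpdate hlam hnu _ _ _
  have nQ₁ : D.NormalQ₁ X' P Q₁ Q₂₀ := hQ₁ ▸ normalQ₁_q₁Update hlam hnu _ _ _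
  have nQ₂ : D.NormalQ₂ X' P Q₁ Q₂ := hQ₂ ▸ normalQ₂_q₂Update hlam hnu _ _ _
  clear hw
  subst hw'
  refine ⟨hX ▸ hmem _ _ _ _, X', vX', nP, nQ₁, nQ₂, fun t ht => ?_⟩
  -- The six decreases telescope in the order of the updates.
  have d1 := fAug_x_descent vX' hX₀
  have d2 := fAug_p_descent hnu nP P₀ A₀
  have d3 := fAug_q₁_descent hnu nQ₁ Q₁₀ A₀
  have d4 := fAug_q₂_descent hnu nQ₂ Q₂₀ A₀
  have d5 := fAug_x_descent vX mX'
  have d6 := fAug_a_descent (D := D) X P Q₁ Q₂ (D.aBest X A₀) A₀ ht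
  linarith

/-! ### Passage to the limit -/

theorem continuous_aBest (hM : ∀ i t₁ t₂, 0 < D.M i t₁ t₂) :
    Continuous fun z : Tensor E T₁ T₂ × Tensor F T₁ T₂ => D.aBest z.1 z.2 := by
  unfold aBest
  refine continuous_pi fun i => continuous_pi fun j => continuous_pi fun k =>
    -- The denominator depends only on the data, so its zeros cause no discontinuity.
    ((continuous_softThreshold (hM i j k).le).comp ?_).div_const _
  have h : Continuous fun z : Tensor E T₁ T₂ × Tensor F T₁ T₂ =>
      (D.maskW ^ 2 * (D.Y - z.1 - z.2.modeOne D.R)).modeOne D.R.transpose := by fun_prop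
  fun_prop

theorem continuous_stepNum_aBest (hM : ∀ i t₁ t₂, 0 < D.M i t₁ t₂) :
    Continuous fun z : Tensor E T₁ T₂ × Tensor F T₁ T₂ =>
      D.stepNum z.1 (D.aBest z.1 z.2) z.2 := by
  have h := continuous_aBest hM
  simp only [stepNum_eq, dataGrad]
  fun_prop

theorem continuous_stepDen_aBest (hM : ∀ i t₁ t₂, 0 < D.M i t₁ t₂) :
    Continuous fun z : Tensor E T₁ T₂ × Tensor F T₁ T₂ => D.stepDen (D.aBest z.1 z.2) z.2 := by
  have h := continuous_aBest hM
  simp only [stepDen]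
  fun_prop

theorem XVarIneq.of_tendsto {S : Set (Tensor E T₁ T₂)} {u : ℕ → Tensor E T₁ T₂}
    {v : ℕ → AugState E F T₁ T₂ N}
    (h : ∀ n, D.XVarIneq S (u n) (v n).2.1 (v n).2.2.1 (v n).2.2.2.1 (v n).2.2.2.2)
    {z : AugState E F T₁ T₂ N} (hu : Tendsto u atTop (𝓝 z.1)) (hv : Tendsto v atTop (𝓝 z)) :
    D.XVarIneq S z.1 z.2.1 z.2.2.1 z.2.2.2.1 z.2.2.2.2 := by
  intro V hV
  have hc : Continuous fun y : Tensor E T₁ T₂ × AugState E F T₁ T₂ N =>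
      (D.dataGrad y.1 y.2.2.2.2.2 + D.nu • (y.1 - cpd y.2.2.1 y.2.2.2.1 y.2.2.2.2.1)).inn
        (V - y.1) := by
    unfold dataGrad
    fun_prop
  exact ge_of_tendsto' ((hc.tendsto (z.1, z)).comp (hu.prodMk_nhds hv)) fun n => h n V hV

/-- The normal equations are closed conditions. -/
theorem NormalP.of_tendsto {X : ℕ → Tensor E T₁ T₂} {P : ℕ → Matrix (Fin E) (Fin N) ℝ}
    {Q₁ : ℕ → Matrix (Fin T₁) (Fin N) ℝ} {Q₂ : ℕ → Matrix (Fin T₂) (Fin N) ℝ}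
    (h : ∀ n, D.NormalP (X n) (P n) (Q₁ n) (Q₂ n)) {x : Tensor E T₁ T₂}
    {p : Matrix (Fin E) (Fin N) ℝ} {q₁ : Matrix (Fin T₁) (Fin N) ℝ}
    {q₂ : Matrix (Fin T₂) (Fin N) ℝ} (hX : Tendsto X atTop (𝓝 x)) (hP : Tendsto P atTop (𝓝 p))
    (hQ₁ : Tendsto Q₁ atTop (𝓝 q₁)) (hQ₂ : Tendsto Q₂ atTop (𝓝 q₂)) :
    D.NormalP x p q₁ q₂ := by
  intro H
  have hc : Continuous fun y : Tensor E T₁ T₂ × Matrix (Fin E) (Fin N) ℝ ×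
      Matrix (Fin T₁) (Fin N) ℝ × Matrix (Fin T₂) (Fin N) ℝ =>
      D.nu * (y.1 - cpd y.2.1 y.2.2.1 y.2.2.2).inn (cpd H y.2.2.1 y.2.2.2)
        - D.lam * matInn y.2.1 H := by
    fun_prop
  have ht := (hc.tendsto (x, p, q₁, q₂)).comp
    (hX.prodMk_nhds (hP.prodMk_nhds (hQ₁.prodMk_nhds hQ₂)))
  exact sub_eq_zero.1 (tendsto_nhds_unique (ht.congr fun n => sub_eq_zero.2 (h n H))
    tendsto_const_nhds)

theorem NormalQ₁.of_tendsto {X : ℕ → Tensor E T₁ T₂} {P : ℕ → Matrix (Fin E) (Fin N) ℝ}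
    {Q₁ : ℕ → Matrix (Fin T₁) (Fin N) ℝ} {Q₂ : ℕ → Matrix (Fin T₂) (Fin N) ℝ}
    (h : ∀ n, D.NormalQ₁ (X n) (P n) (Q₁ n) (Q₂ n)) {x : Tensor E T₁ T₂}
    {p : Matrix (Fin E) (Fin N) ℝ} {q₁ : Matrix (Fin T₁) (Fin N) ℝ}
    {q₂ : Matrix (Fin T₂) (Fin N) ℝ} (hX : Tendsto X atTop (𝓝 x)) (hP : Tendsto P atTop (𝓝 p))
    (hQ₁ : Tendsto Q₁ atTop (𝓝 q₁)) (hQ₂ : Tendsto Q₂ atTop (𝓝 q₂)) :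
    D.NormalQ₁ x p q₁ q₂ := by
  intro H
  have hc : Continuous fun y : Tensor E T₁ T₂ × Matrix (Fin E) (Fin N) ℝ ×
      Matrix (Fin T₁) (Fin N) ℝ × Matrix (Fin T₂) (Fin N) ℝ =>
      D.nu * (y.1 - cpd y.2.1 y.2.2.1 y.2.2.2).inn (cpd y.2.1 H y.2.2.2)
        - D.lam * matInn y.2.2.1 H := by
    fun_prop
  have ht := (hc.tendsto (x, p, q₁, q₂)).comp
    (hX.prodMk_nhds (hP.prodMk_nhds (hQ₁.prodMk_nhds hQ₂)))
  exact sub_eq_zero.1 (tendsto_nhds_unique (ht.congr fun n => sub_eq_zero.2 (h n H))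
    tendsto_const_nhds)

theorem NormalQ₂.of_tendsto {X : ℕ → Tensor E T₁ T₂} {P : ℕ → Matrix (Fin E) (Fin N) ℝ}
    {Q₁ : ℕ → Matrix (Fin T₁) (Fin N) ℝ} {Q₂ : ℕ → Matrix (Fin T₂) (Fin N) ℝ}
    (h : ∀ n, D.NormalQ₂ (X n) (P n) (Q₁ n) (Q₂ n)) {x : Tensor E T₁ T₂}
    {p : Matrix (Fin E) (Fin N) ℝ} {q₁ : Matrix (Fin T₁) (Fin N) ℝ}
    {q₂ : Matrix (Fin T₂) (Fin N) ℝ} (hX : Tendsto X atTop (𝓝 x)) (hP : Tendsto P atTop (𝓝 p))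
    (hQ₁ : Tendsto Q₁ atTop (𝓝 q₁)) (hQ₂ : Tendsto Q₂ atTop (𝓝 q₂)) :
    D.NormalQ₂ x p q₁ q₂ := by
  intro H
  have hc : Continuous fun y : Tensor E T₁ T₂ × Matrix (Fin E) (Fin N) ℝ ×
      Matrix (Fin T₁) (Fin N) ℝ × Matrix (Fin T₂) (Fin N) ℝ =>
      D.nu * (y.1 - cpd y.2.1 y.2.2.1 y.2.2.2).inn (cpd y.2.1 y.2.2.1 H)
        - D.lam * matInn y.2.2.2 H := by
    fun_prop
  have ht := (hc.tendsto (x, p, q₁, q₂)).comp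
    (hX.prodMk_nhds (hP.prodMk_nhds (hQ₁.prodMk_nhds hQ₂)))
  exact sub_eq_zero.1 (tendsto_nhds_unique (ht.congr fun n => sub_eq_zero.2 (h n H))
    tendsto_const_nhds)

theorem nonneg_of_forall_quadratic_nonneg {n d : ℝ}
    (h : ∀ t ∈ Set.Icc (0 : ℝ) 1, 0 ≤ t * n + t ^ 2 / 2 * d) : 0 ≤ n := by
  by_contra! hn
  have hd : 0 < |d| + -n := by have := abs_nonneg d; linarith
  -- For this `t > 0`, `t * |d| = -n + t * n`, so `n + t / 2 * d ≤ (n + t * n) / 2 < 0`.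
  have hs : -n / (|d| + -n) ∈ Set.Icc (0 : ℝ) 1 :=
    ⟨div_nonneg (by linarith) hd.le, (div_le_one hd).2 (by have := abs_nonneg d; linarith)⟩
  have ht : 0 < -n / (|d| + -n) := div_pos (by linarith) hd
  have h1 := h _ hs
  set t := -n / (|d| + -n)
  have h2 : t * (|d| + -n) = -n := div_mul_cancel₀ _ hd.ne'
  have h3 : 0 ≤ n + t / 2 * d := by
    by_contra! h4
    nlinarith
  have h5 : t * d ≤ t * |d| := mul_le_mul_of_nonneg_left (le_abs_self d) ht.le
  nlinarith

theorem isStationaryOn_of_isLimitPoint (hM : ∀ i t₁ t₂, 0 < D.M i t₁ t₂) (hlam : 0 < D.lam)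
    (hnu : 0 < D.nu) {S : Set (Tensor E T₁ T₂)} (hS : IsClosed S)
    {upd : Matrix (Fin E) (Fin N) ℝ → Matrix (Fin T₁) (Fin N) ℝ →
      Matrix (Fin T₂) (Fin N) ℝ → Tensor F T₁ T₂ → Tensor E T₁ T₂}
    (hmem : ∀ P Q₁ Q₂ A, upd P Q₁ Q₂ A ∈ S)
    (hvi : ∀ P Q₁ Q₂ A, D.XVarIneq S (upd P Q₁ Q₂ A) P Q₁ Q₂ A)
    (z₀ : Factors E F T₁ T₂ N) {z : AugState E F T₁ T₂ N}
    (hz : IsLimitPoint (D.iterates upd z₀) z) :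
    IsStationaryOn D.fAug {z : AugState E F T₁ T₂ N | z.1 ∈ S} z := by
  obtain ⟨φ, hφ, hlim⟩ := hz
  set u := D.iterates upd z₀ with hu
  -- Entry `0` is already the output of an iteration, so its `X̃` comes from `upd`.
  have hfeas (n : ℕ) : (u n).1 ∈ S := by
    cases n <;> exact hmem _ _ _ _
  have hspec (n : ℕ) := (step_spec hlam hnu hmem hvi (u n).1 (u n).2.1 (u n).2.2.1
    (u n).2.2.2.1 (u n).2.2.2.2 (hfeas n) (u (n + 1)) rfl).2
  choose X' hX' hP hQ₁ hQ₂ hdesc using hspec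
  have hanti : Antitone fun n => D.fAug (u n) := by
    refine antitone_nat_of_succ_le fun n => ?_
    have h := hdesc n 0 (by simp)
    have h1 := mul_nonneg hnu.le ((u n).1 - X' n).frobSq_nonneg
    have h2 := mul_nonneg hnu.le (X' n - (u (n + 1)).1).frobSq_nonneg
    have h3 := mul_nonneg hlam.le (matFrobSq_nonneg ((u n).2.1 - (u (n + 1)).2.1))
    have h4 := mul_nonneg hlam.le (matFrobSq_nonneg ((u n).2.2.1 - (u (n + 1)).2.2.1))
    have h5 := mul_nonneg hlam.le (matFrobSq_nonneg ((u n).2.2.2.1 - (u (n + 1)).2.2.2.1))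
    linarith
  have hgap := (tendsto_sub_succ_of_antitone hanti
    fun n => fAug_nonneg hlam hnu (u n)).comp hφ.tendsto_atTop
  have hle (n : ℕ) (t : ℝ) (ht : t ∈ Set.Icc (0 : ℝ) 1) := hdesc (φ n) t ht
  have h1 (n : ℕ) := mul_nonneg hnu.le ((u (φ n)).1 - X' (φ n)).frobSq_nonneg
  have h2 (n : ℕ) := mul_nonneg hnu.le (X' (φ n) - (u (φ n + 1)).1).frobSq_nonneg
  have h3 (n : ℕ) := mul_nonneg hlam.le (matFrobSq_nonneg ((u (φ n)).2.1 - (u (φ n + 1)).2.1))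
  have h4 (n : ℕ) :=
    mul_nonneg hlam.le (matFrobSq_nonneg ((u (φ n)).2.2.1 - (u (φ n + 1)).2.2.1))
  have h5 (n : ℕ) :=
    mul_nonneg hlam.le (matFrobSq_nonneg ((u (φ n)).2.2.2.1 - (u (φ n + 1)).2.2.2.1))
  have h0 (n : ℕ) := hdesc (φ n) 0 (by simp)
  have hfst := hlim.fst_nhds
  have hsnd := hlim.snd_nhds
  -- Taking `t = 0` in the decrease bounds every squared change by the vanishing gap. The
  -- intermediate `X'` and then the new `X`, `P`, `Q₁`, `Q₂` inherit the limits of the old blocks.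
  have lX' : Tendsto (fun n => X' (φ n)) atTop (𝓝 z.1) :=
    tendsto_of_frobSq_sub_le (half_pos hnu) hfst hgap fun n => by
      simp only [Function.comp_apply]; linarith [h0 n, h2 n, h3 n, h4 n, h5 n]
  have lX : Tendsto (fun n => (u (φ n + 1)).1) atTop (𝓝 z.1) :=
    tendsto_of_frobSq_sub_le (half_pos hnu) lX' hgap fun n => by
      simp only [Function.comp_apply]; linarith [h0 n, h1 n, h3 n, h4 n, h5 n]
  have lP : Tendsto (fun n => (u (φ n + 1)).2.1) atTop (𝓝 z.2.1) :=
    tendsto_of_matFrobSq_sub_le (half_pos hlam) hsnd.fst_nhds hgap fun n => by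
      simp only [Function.comp_apply]; linarith [h0 n, h1 n, h2 n, h4 n, h5 n]
  have lQ₁ : Tendsto (fun n => (u (φ n + 1)).2.2.1) atTop (𝓝 z.2.2.1) :=
    tendsto_of_matFrobSq_sub_le (half_pos hlam) hsnd.snd_nhds.fst_nhds hgap fun n => by
      simp only [Function.comp_apply]; linarith [h0 n, h1 n, h2 n, h3 n, h5 n]
  have lQ₂ : Tendsto (fun n => (u (φ n + 1)).2.2.2.1) atTop (𝓝 z.2.2.2.1) :=
    tendsto_of_matFrobSq_sub_le (half_pos hlam) hsnd.snd_nhds.snd_nhds.fst_nhds hgap fun n => by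
      simp only [Function.comp_apply]; linarith [h0 n, h1 n, h2 n, h3 n, h4 n]
  -- This is the old `A`, the input of the iteration; convergence of the new one is neither known
  -- nor needed.
  have lA := hsnd.snd_nhds.snd_nhds.snd_nhds
  have lQ₁₀ := hsnd.snd_nhds.fst_nhds
  have lQ₂₀ := hsnd.snd_nhds.snd_nhds.fst_nhds
  have hnum : 0 ≤ D.stepNum z.1 (D.aBest z.1 z.2.2.2.2) z.2.2.2.2 := by
    refine nonneg_of_forall_quadratic_nonneg (d := D.stepDen (D.aBest z.1 z.2.2.2.2) z.2.2.2.2)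
      fun t ht => ?_
    have ln := ((continuous_stepNum_aBest hM).tendsto (z.1, z.2.2.2.2)).comp (lX.prodMk_nhds lA)
    have ld := ((continuous_stepDen_aBest hM).tendsto (z.1, z.2.2.2.2)).comp (lX.prodMk_nhds lA)
    have hs := hgap.add ((ln.const_mul t).add (ld.const_mul (t ^ 2 / 2)))
    rw [zero_add] at hs
    refine ge_of_tendsto' hs fun n => ?_
    have := hdesc (φ n) t ht
    simp only [Function.comp_apply]
    linarith [h1 n, h2 n, h3 n, h4 n, h5 n]
  -- The block conditions hold at mixtures of old and new blocks; equal limits turn them all into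
  -- conditions at `z`.
  exact fAug_isStationaryOn hM (hS.mem_of_tendsto hfst (Eventually.of_forall fun n => hfeas _))
    (XVarIneq.of_tendsto (fun n => hX' (φ n)) lX' hlim)
    (NormalP.of_tendsto (fun n => hP (φ n)) lX' lP lQ₁₀ lQ₂₀)
    (NormalQ₁.of_tendsto (fun n => hQ₁ (φ n)) lX' lP lQ₁ lQ₂₀)
    (NormalQ₂.of_tendsto (fun n => hQ₂ (φ n)) lX' lP lQ₁ lQ₂) hnum

end AugData

theorem proposition2 {E F T₁ T₂ N : ℕ} (D : AugData E F T₁ T₂)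
    (hO : ∀ j t₁ t₂, D.O j t₁ t₂ = 0 ∨ D.O j t₁ t₂ = 1)
    (hW : ∀ j t₁ t₂, 0 < D.W j t₁ t₂)
    (hM : ∀ i t₁ t₂, 0 < D.M i t₁ t₂)
    (hlam : 0 < D.lam) (hnu : 0 < D.nu)
    (z₀ : Factors E F T₁ T₂ N) :
    (∀ z : AugState E F T₁ T₂ N,
        IsLimitPoint (D.iterates D.xUpdate z₀) z → IsStationaryOn D.fAug Set.univ z) ∧
      (∀ z : AugState E F T₁ T₂ N,
        IsLimitPoint (D.iterates D.xUpdateNonneg z₀) z →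
          IsStationaryOn D.fAug AugData.nonnegSet z) := by
  constructor
  · intro z hz
    have h := AugData.isStationaryOn_of_isLimitPoint hM hlam hnu isClosed_univ
      (fun _ _ _ _ => Set.mem_univ _) (AugData.xVarIneq_xUpdate hnu) z₀ hz
    simpa using h
  · intro z hz
    have hclosed : IsClosed {X : Tensor E T₁ T₂ | ∀ i j k, 0 ≤ X i j k} := by
      simp only [Set.ofPred_forall]
      exact isClosed_iInter fun i => isClosed_iInter fun j => isClosed_iInter fun k =>
        isClosed_le continuous_const (by fun_prop)
    exact AugData.isStationaryOn_of_isLimitPoint hM hlam hnu hclosed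
      (fun _ _ _ _ _ _ _ => le_max_right _ _) (AugData.xVarIneq_xUpdateNonneg hnu) z₀ hz
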